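/- Let $\mu\in(0,1)$, $\alpha,\beta>-1$ and $N\ge 1$ an integer. Let $P_n^{(a,b)}$ be the Jacobi polynomials in Szegő's normalization, $$P_n^{(a,b)}(x)=\frac{\Gamma(n+a+1)}{n!\,\Gamma(a+1)}\,{}_2F_1\Big(-n,n+a+b+1;a+1;\frac{1-x}{2}\Big),$$ let $P_n=P_n^{(0,0)}$ be the Legendre polynomials, and put $\omega^{(a,b)}(x)=(1-x)^a(1+x)^b$ and $$\gamma_n^{(a,b)}=\frac{2^{a+b+1}\Gamma(n+a+1)\Gamma(n+b+1)}{(2n+a+b+1)\,n!\,\Gamma(n+a+b+1)},$$ where for $n=0$ the factor $(a+b+1)\Gamma(a+b+1)$ is read as $\Gamma(a+b+2)$. Let $-1=x_0<x_1<\dots<x_N=1$ be the Jacobi–Gauss–Lobatto points, i.e. the zeros of $(1-x^2)\frac{d}{dx}P_N^{(\alpha,\beta)}(x)$, let $h_0,\dots,h_N$ be the Lagrange interpolating basis polynomials at these points, and let $\omega_j=\int_{-1}^1 h_j(x)\,\omega^{(\alpha,\beta)}(x)\,dx$ be the corresponding quadrature weights. For functions $u$ on $[-1,1]$ define the modified Riemann–Liouville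 derivative of order $\mu$ by $$\big({}^R\widehat D_-^{\mu}u\big)(x)=(1+x)^{\mu}\,\frac{d}{dx}\left(\frac{1}{\Gamma(1-\mu)}\int_{-1}^x\frac{u(y)}{(x-y)^{\mu}}\,dy\right).$$ Then for each $0\le j\le N$ there is exactly one polynomial $\widehat Q_j^{\mu}$ of degree at most $N$ such that $$\big({}^R\widehat D_-^{\mu}\widehat Q_j^{\mu}\big)(x_i)=\delta_{ij}\quad(1\le i\le N),\qquad \widehat Q_j^{\mu}(-1)=\delta_{0j},$$ and it is given by $$\widehat Q_j^{\mu}(x)=\zeta_j\sum_{l=0}^N\frac{\Gamma(l-\mu+1)}{l!}\,\hat t_{lj}\,P_l(x),\qquad \hat t_{lj}=\sum_{n=l}^N C_{ln}\,t_{nj},$$ where $\zeta_0=1/\Gamma(1-\mu)$ and $\zeta_j=1$ for $1\le j\le N$, the $$C_{ln}=\frac{1}{\gamma_l^{(\mu,-\mu)}}\int_{-1}^1P_l^{(\mu,-\mu)}(x)\,P_n^{(\alpha,\beta)}(x)\,\omega^{(\mu,-\mu)}(x)\,dx$$ are the connection coefficients from $(\alpha,\beta)$ to $(\mu,-\mu)$,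 and $$t_{nj}=\frac{\omega_j}{\tilde\gamma_n}\,P_n^{(\alpha,\beta)}(x_j),\qquad \tilde\gamma_n=\gamma_n^{(\alpha,\beta)}\ (0\le n\le N-1),\qquad \tilde\gamma_N=\Big(2+\frac{\alpha+\beta+1}{N}\Big)\gamma_N^{(\alpha,\beta)}.$$ -/

import Mathlib

open Polynomial

noncomputable section

namespace RLBirkhoff

/-- The Jacobi polynomial `P_n^{(a,b)}` in the normalization of Szego, i.e.
`Γ(n+a+1) / (n! Γ(a+1)) * ₂F₁(-n, n+a+b+1; a+1; (1-x)/2)`, written out as the finite sum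
`(1/n!) ∑_k binom(n,k) (n+a+b+1)_k (a+k+1)_{n-k} ((x-1)/2)^k`
(`(z)_k` the rising factorial), which makes sense for all real `a`, `b`. -/
def jacobi (a b : ℝ) (n : ℕ) : ℝ[X] :=
  ∑ k ∈ Finset.range (n + 1),
    C ((n.choose k : ℝ) * (ascPochhammer ℝ k).eval ((n : ℝ) + a + b + 1)
        * (ascPochhammer ℝ (n - k)).eval (a + (k : ℝ) + 1) / (n.factorial : ℝ))
      * (C (1 / 2 : ℝ) * (X - 1)) ^ k

/-- The Legendre polynomial `P_n = P_n^{(0,0)}`. -/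
def legendre (n : ℕ) : ℝ[X] := jacobi 0 0 n

/-- The Jacobi weight function `(1-x)^a (1+x)^b`. -/
def jacobiWeight (a b x : ℝ) : ℝ := (1 - x) ^ a * (1 + x) ^ b

/-- The normalization constant `γ_n^{(a,b)}` of the Jacobi polynomials. For `n = 0` the
general expression has the factor `(a+b+1) Γ(a+b+1)`, which is to be read as `Γ(a+b+2)`
(this matters only if `a + b = -1`). -/
def jacobiGamma (a b : ℝ) (n : ℕ) : ℝ :=
  if n = 0 then
    2 ^ (a + b + 1) * Real.Gamma (a + 1) * Real.Gamma (b + 1) / Real.Gamma (a + b + 2)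
  else
    2 ^ (a + b + 1) * Real.Gamma ((n : ℝ) + a + 1) * Real.Gamma ((n : ℝ) + b + 1)
      / ((2 * (n : ℝ) + a + b + 1) * (n.factorial : ℝ) * Real.Gamma ((n : ℝ) + a + b + 1))

/-- The modified constants: `γ_n` for `n < N`, and `(2 + (a+b+1)/N) γ_N` for `n = N`. -/
def jacobiGammaTilde (a b : ℝ) (N n : ℕ) : ℝ :=
  if n = N then (2 + (a + b + 1) / (N : ℝ)) * jacobiGamma a b N else jacobiGamma a b n

/-- The Jacobi-Gauss-Lobatto points: the `j`-th zero, in ascending order and counted from `0`,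
of `(1 - x^2) (d/dx) P_N^{(a,b)}(x)`. For `a, b > -1` and `N ≥ 1` there are exactly `N + 1`
of them; the value `0` outside this range of `j` is a dummy. -/
def jglNode (a b : ℝ) (N j : ℕ) : ℝ :=
  ((((1 - X ^ 2) * derivative (jacobi a b N)).roots.toFinset).sort (· ≤ ·)).getD j 0

/-- The Lagrange interpolating basis polynomials `h_j` at the Jacobi-Gauss-Lobatto points. -/
def jglLagrange (a b : ℝ) (N j : ℕ) : ℝ[X] :=
  Lagrange.basis (Finset.range (N + 1)) (jglNode a b N) j

/-- The Jacobi-Gauss-Lobatto quadrature weights: `ω_j = ∫ h_j(x) (1-x)^a (1+x)^b dx`, the only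
weights for which the quadrature at these points integrates all polynomials of degree at
most `N` exactly. -/
def jglWeight (a b : ℝ) (N j : ℕ) : ℝ :=
  ∫ x in (-1 : ℝ)..1, (jglLagrange a b N j).eval x * jacobiWeight a b x

/-- The connection coefficient from `(α,β)` to `(a,b)`:
`(1/γ_l^{(a,b)}) ∫ P_l^{(a,b)}(x) P_n^{(α,β)}(x) (1-x)^a (1+x)^b dx`. -/
def connCoeff (α β a b : ℝ) (l n : ℕ) : ℝ :=
  1 / jacobiGamma a b l *
    ∫ x in (-1 : ℝ)..1, (jacobi a b l).eval x * (jacobi α β n).eval x * jacobiWeight a b x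

/-- The coefficients `t_{nj} = (ω_j / γ̃_n) P_n^{(α,β)}(x_j)`. -/
def tCoeff (α β : ℝ) (N n j : ℕ) : ℝ :=
  jglWeight α β N j / jacobiGammaTilde α β N n * (jacobi α β n).eval (jglNode α β N j)

/-- Their transforms `t̂_{lj}`, the sum over `n = l, …, N` of the connection coefficients
from `(α,β)` to `(μ,-μ)` times `t_{nj}`. -/
def tHat (α β μ : ℝ) (N l j : ℕ) : ℝ :=
  ∑ n ∈ Finset.Icc l N, connCoeff α β μ (-μ) l n * tCoeff α β N n j

/-- The left-sided fractional integral of order `ρ > 0` based at `-1`. -/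
def fracInt (ρ : ℝ) (u : ℝ → ℝ) (x : ℝ) : ℝ :=
  1 / Real.Gamma ρ * ∫ y in (-1 : ℝ)..x, u y / (x - y) ^ (1 - ρ)

/-- The left-sided Riemann-Liouville derivative of order `μ` based at `-1`, for non-integer
`μ > 0`: the `k`-th derivative of the fractional integral of order `k - μ`, where
`k - 1 < μ < k`. -/
def rlDeriv (μ : ℝ) (u : ℝ → ℝ) (x : ℝ) : ℝ :=
  iteratedDeriv ⌈μ⌉₊ (fracInt ((⌈μ⌉₊ : ℝ) - μ) u) x

/-- The modified Riemann-Liouville derivative `(1+x)^μ` times the Riemann-Liouville one. -/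
def modRLDeriv (μ : ℝ) (u : ℝ → ℝ) (x : ℝ) : ℝ := (1 + x) ^ μ * rlDeriv μ u x

/-- `Q` is a `j`-th modified Riemann-Liouville Birkhoff interpolating basis polynomial of order
`μ ∈ (0,1)` at the Jacobi-Gauss-Lobatto points `x_0 < … < x_N` (`0 ≤ j ≤ N`): a polynomial of
degree at most `N` whose modified Riemann-Liouville derivative takes the value `δ_{ij}`
at `x_i` for `1 ≤ i ≤ N`, and whose value at `-1` is `δ_{0j}`. -/
structure IsBirkhoffBasisPoly (α β μ : ℝ) (N j : ℕ) (Q : ℝ[X]) : Prop where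
  degree_le : Q.degree ≤ (N : WithBot ℕ)
  deriv_node : ∀ i : ℕ, 1 ≤ i → i ≤ N →
    modRLDeriv μ (fun x => Q.eval x) (jglNode α β N i) = if i = j then 1 else 0
  value_left : Q.eval (-1) = if j = 0 then 1 else 0

/-- `ζ_0 = 1/Γ(1-μ)` and `ζ_j = 1` for `j ≥ 1`. -/
def zetaConst (μ : ℝ) (j : ℕ) : ℝ := if j = 0 then 1 / Real.Gamma (1 - μ) else 1

end RLBirkhoff

end

/-! On polynomials the modified derivative acts diagonally: at every `x > -1` it sends `(1+x)^k` to
`k!/Γ(k+1-μ)` times itself. `modRLOp` is that operator on `ℝ[X]`. Its multipliers are nonzero, so it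
is injective, and its constant term at `-1` turns the condition on `Q(-1)` into an interpolation
condition at `x_0 = -1`; this is where `ζ_0` comes from. Hence the Birkhoff conditions say exactly
that `deg Q ≤ N` and `modRLOp μ Q = ζ_j h_j` (`isBirkhoffBasisPoly_iff`).

It remains to find a preimage of `ζ_j h_j`. The discrete orthogonality of the Lobatto quadrature
expands `h_j` in `P_n^{(α,β)}` with coefficients `t_{nj}` (`jglLagrange_eq_sum`), and the connection
coefficients rewrite this in `P_l^{(μ,-μ)}` with coefficients `t̂_{lj}`. Finally `modRLOp` maps
`P_l` to `l!/Γ(l+1-μ)` times `P_l^{(μ,-μ)}` (`modRLOp_legendre`), so dividing by these factors gives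
the formula.

The supporting theory (orthogonality, norms, zeros, quadrature exactness) all grows out of the
Jacobi differential equation and one integration by parts. -/

namespace RLBirkhoff

/-! ### Jacobi polynomials: coefficients, differential equation, reflection -/

/-- The coefficient of `((x-1)/2)^k` in the Jacobi polynomial. -/
noncomputable def jacobiCoeff (a b : ℝ) (n k : ℕ) : ℝ :=
  (n.choose k : ℝ) * (ascPochhammer ℝ k).eval ((n : ℝ) + a + b + 1)
        * (ascPochhammer ℝ (n - k)).eval (a + (k : ℝ) + 1) / (n.factorial : ℝ)

/-- The Jacobi polynomial in the variable `(x-1)/2`. -/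
noncomputable def jacobiAux (a b : ℝ) (n : ℕ) : ℝ[X] :=
  ∑ k ∈ Finset.range (n + 1), C (jacobiCoeff a b n k) * X ^ k

theorem jacobi_eq_comp (a b : ℝ) (n : ℕ) :
    jacobi a b n = (jacobiAux a b n).comp (C (1 / 2 : ℝ) * (X - 1)) := by
  simp only [jacobi, jacobiAux, jacobiCoeff, Polynomial.sum_comp, mul_comp, C_comp,
    X_pow_comp]

theorem jacobiCoeff_of_lt (a b : ℝ) {n k : ℕ} (h : n < k) : jacobiCoeff a b n k = 0 := by
  simp [jacobiCoeff, Nat.choose_eq_zero_of_lt h]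

theorem jacobiAux_coeff (a b : ℝ) (n k : ℕ) :
    (jacobiAux a b n).coeff k = jacobiCoeff a b n k := by
  simp only [jacobiAux, finsetSum_coeff, coeff_C_mul_X_pow]
  rw [Finset.sum_ite_eq]
  split_ifs with h
  · rfl
  · rw [jacobiCoeff_of_lt]
    simpa using h

theorem ascPochhammer_eval_succ_left (z : ℝ) (k : ℕ) :
    (ascPochhammer ℝ (k + 1)).eval z = z * (ascPochhammer ℝ k).eval (z + 1) := by
  rw [ascPochhammer_succ_left]
  simp [eval_comp]

/-- The hypergeometric term ratio, cross-multiplied so that it needs no condition on `a`, `b` and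
survives for `k ≥ n`, where both sides vanish. Coefficientwise, it is the differential equation. -/
theorem jacobiCoeff_succ (a b : ℝ) (n k : ℕ) :
    jacobiCoeff a b n (k + 1) * ((k + 1) * (k + a + 1)) =
      jacobiCoeff a b n k * ((n - k) * (n + k + a + b + 1)) := by
  rcases lt_trichotomy n k with h | rfl | h
  · rw [jacobiCoeff_of_lt a b h, jacobiCoeff_of_lt a b (h.trans k.lt_succ_self)]; simp
  · rw [jacobiCoeff_of_lt a b n.lt_succ_self]; simp
  · obtain ⟨m, rfl⟩ := Nat.exists_eq_add_of_lt h
    have e1 : k + m + 1 - k = m + 1 := by omega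
    have e2 : k + m + 1 - (k + 1) = m := by omega
    have hc : ((k + m + 1).choose (k + 1) : ℝ) * (k + 1) = (k + m + 1).choose k * (m + 1) := by
      have := Nat.choose_succ_right_eq (k + m + 1) k
      rw [e1] at this
      exact_mod_cast this
    simp only [jacobiCoeff, e1, e2]
    rw [ascPochhammer_eval_succ_left (a + k + 1) m, ascPochhammer_succ_eval]
    push_cast
    have e3 : a + ((k : ℝ) + 1) + 1 = a + k + 1 + 1 := by ring
    rw [e3]
    have e4 : (k : ℝ) + m + 1 - k = m + 1 := by ring
    rw [e4]
    linear_combination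
      (((ascPochhammer ℝ k).eval ((k : ℝ) + m + 1 + a + b + 1) * (k + m + 1 + a + b + 1 + k)) *
        (ascPochhammer ℝ m).eval (a + k + 1 + 1) / ((k + m + 1).factorial : ℝ) * (k + a + 1)) * hc

theorem jacobiAux_ode (a b : ℝ) (n : ℕ) :
    X * (X + 1) * derivative (derivative (jacobiAux a b n)) +
      (C (a + 1) + C (a + b + 2) * X) * derivative (jacobiAux a b n) =
      C ((n : ℝ) * (n + a + b + 1)) * jacobiAux a b n := by
  have e : X * (X + 1) * derivative (derivative (jacobiAux a b n)) +
      (C (a + 1) + C (a + b + 2) * X) * derivative (jacobiAux a b n) =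
      X * (X * derivative (derivative (jacobiAux a b n))) +
      X * derivative (derivative (jacobiAux a b n)) + C (a + 1) * derivative (jacobiAux a b n)
      + C (a + b + 2) * (X * derivative (jacobiAux a b n)) := by ring
  rw [e]
  ext k
  rcases k with _ | _ | k
  · have := jacobiCoeff_succ a b n 0
    simp [coeff_derivative, jacobiAux_coeff] at this ⊢
    linear_combination this
  · have := jacobiCoeff_succ a b n 1
    simp only [coeff_add, coeff_C_mul, coeff_X_mul, coeff_X_mul_zero, coeff_derivative,
      jacobiAux_coeff]
    push_cast at this ⊢
    linear_combination this
  · have := jacobiCoeff_succ a b n (k + 2)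
    simp only [coeff_add, coeff_C_mul, coeff_X_mul, coeff_derivative, jacobiAux_coeff]
    push_cast at this ⊢
    linear_combination this

theorem jacobi_derivative_eq_comp (a b : ℝ) (n : ℕ) :
    derivative (jacobi a b n) =
      C (1 / 2) * (derivative (jacobiAux a b n)).comp (C (1 / 2 : ℝ) * (X - 1)) := by
  rw [jacobi_eq_comp, derivative_comp]
  simp

theorem C_half_mul_two : (C (1 / 2 : ℝ) : ℝ[X]) * 2 = 1 := by
  rw [← C_ofNat, ← C_mul]; norm_num

/-- The Jacobi differential equation. -/
theorem jacobi_ode (a b : ℝ) (n : ℕ) :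
    (1 - X ^ 2) * derivative (derivative (jacobi a b n)) +
      (C (b - a) - C (a + b + 2) * X) * derivative (jacobi a b n) =
      - (C ((n : ℝ) * (n + a + b + 1)) * jacobi a b n) := by
  have h := congrArg (fun p => p.comp (C (1 / 2 : ℝ) * (X - 1))) (jacobiAux_ode a b n)
  simp only [add_comp, mul_comp, X_comp, one_comp, C_comp] at h
  rw [jacobi_derivative_eq_comp, derivative_C_mul, derivative_comp, jacobi_eq_comp, ← h]
  simp only [C_add, C_sub, derivative_mul, derivative_C, derivative_sub, derivative_X,
    derivative_one, C_1, C_ofNat]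
  set c : ℝ[X] := C (1 / 2 : ℝ) with hc
  have hcc : c * 2 = 1 := C_half_mul_two
  -- In the variable `t = (X-1)/2` the claim is a polynomial identity modulo the single relation `2c
  -- = 1`.
  have hX : (X : ℝ[X]) = 2 * (c * (X - 1)) + 1 := by linear_combination (1 - X) * hcc
  set D2 := (derivative (derivative (jacobiAux a b n))).comp (c * (X - 1))
  set D1 := (derivative (jacobiAux a b n)).comp (c * (X - 1))
  clear_value D2 D1 c
  generalize ht : c * (X - 1) = t at *
  rw [hX]
  linear_combination (-(1 + 2 * c) * D2 * (t ^ 2 + t)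
    - D1 * (t * (C a + C b + 2) + C a + 1)) * hcc

theorem jacobiAux_natDegree_le (a b : ℝ) (n : ℕ) : (jacobiAux a b n).natDegree ≤ n := by
  rw [natDegree_le_iff_coeff_eq_zero]
  intro k hk
  rw [jacobiAux_coeff, jacobiCoeff_of_lt a b hk]

/-- For `n ≥ 1` the base `n+a+b+1` of the rising factorial is positive; for `n = 0` the factorial is
empty, so a negative base is harmless. -/
theorem jacobiCoeff_self_pos {a b : ℝ} (hab : -2 < a + b) (n : ℕ) : 0 < jacobiCoeff a b n n := by
  rcases n with _ | n
  · simp [jacobiCoeff]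
  · have : 0 < ((n + 1 : ℕ) : ℝ) + a + b + 1 := by push_cast; linarith [n.cast_nonneg (α := ℝ)]
    have := ascPochhammer_pos (n + 1) _ this
    simp only [jacobiCoeff, Nat.choose_self, Nat.sub_self, ascPochhammer_zero, eval_one]
    positivity

theorem jacobiAux_natDegree {a b : ℝ} (hab : -2 < a + b) (n : ℕ) :
    (jacobiAux a b n).natDegree = n :=
  natDegree_eq_of_le_of_coeff_ne_zero (jacobiAux_natDegree_le a b n)
    (by rw [jacobiAux_coeff]; exact (jacobiCoeff_self_pos hab n).ne')

theorem half_X_sub_one_natDegree : (C (1 / 2 : ℝ) * (X - 1)).natDegree = 1 := by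
  rw [natDegree_C_mul (by norm_num), ← C_1, natDegree_X_sub_C]

theorem jacobi_natDegree {a b : ℝ} (hab : -2 < a + b) (n : ℕ) :
    (jacobi a b n).natDegree = n := by
  rw [jacobi_eq_comp, natDegree_comp, jacobiAux_natDegree hab, half_X_sub_one_natDegree, mul_one]

theorem jacobi_leadingCoeff {a b : ℝ} (hab : -2 < a + b) (n : ℕ) :
    (jacobi a b n).leadingCoeff = jacobiCoeff a b n n * (1 / 2) ^ n := by
  rw [jacobi_eq_comp, leadingCoeff_comp (by rw [half_X_sub_one_natDegree]; norm_num),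
    leadingCoeff, jacobiAux_natDegree hab, jacobiAux_coeff, leadingCoeff_mul, leadingCoeff_C,
    ← C_1, leadingCoeff_X_sub_C, mul_one]

theorem jacobi_ne_zero {a b : ℝ} (hab : -2 < a + b) (n : ℕ) : jacobi a b n ≠ 0 := by
  rw [← leadingCoeff_ne_zero, jacobi_leadingCoeff hab]
  exact mul_ne_zero (jacobiCoeff_self_pos hab n).ne' (by positivity)

theorem jacobi_zero (a b : ℝ) : jacobi a b 0 = 1 := by
  simp [jacobi]

/-- The derivative of a Jacobi polynomial is a multiple of a Jacobi polynomial. -/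
theorem jacobi_succ_derivative (a b : ℝ) (n : ℕ) :
    derivative (jacobi a b (n + 1)) = C ((n + a + b + 2) / 2) * jacobi (a + 1) (b + 1) n := by
  have h : derivative (jacobiAux a b (n + 1)) =
      C (n + a + b + 2) * jacobiAux (a + 1) (b + 1) n := by
    ext k
    rw [coeff_derivative, coeff_C_mul, jacobiAux_coeff, jacobiAux_coeff]
    simp only [jacobiCoeff, Nat.add_sub_add_right, Nat.factorial_succ]
    rw [ascPochhammer_eval_succ_left]
    have hc : ((n + 1).choose (k + 1) : ℝ) * (k + 1) = (n + 1) * n.choose k := by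
      exact_mod_cast (Nat.add_one_mul_choose_eq n k).symm
    push_cast
    have e1 : (n : ℝ) + 1 + a + b + 1 = n + a + b + 2 := by ring
    have e2 : (n : ℝ) + (a + 1) + (b + 1) + 1 = n + a + b + 2 + 1 := by ring
    have e3 : a + ((k : ℝ) + 1) + 1 = a + 1 + k + 1 := by ring
    rw [e1, e2, e3]
    have : (n.factorial : ℝ) ≠ 0 := by positivity
    field_simp
    linear_combination (n + a + b + 2) * (ascPochhammer ℝ k).eval (n + a + b + 2 + 1) *
      (ascPochhammer ℝ (n - k)).eval (a + 1 + k + 1) * hc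
  rw [jacobi_derivative_eq_comp, h, mul_comp, C_comp, ← jacobi_eq_comp, ← mul_assoc, ← C_mul]
  congr 2
  ring

/-- A polynomial solution of the Jacobi differential equation with eigenvalue parameter `n` has
degree `n` or vanishes. -/
theorem natDegree_of_jacobi_ode {s e : ℝ} (hs : -1 < s) {n : ℕ} {y : ℝ[X]} (hy : y ≠ 0)
    (h : (1 - X ^ 2) * derivative (derivative y) + (C e - C (s + 1) * X) * derivative y =
      - (C ((n : ℝ) * (n + s)) * y)) : y.natDegree = n := by
  have h' : derivative (derivative y) - X * (X * derivative (derivative y)) + C e * derivative y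
      - C (s + 1) * (X * derivative y) = - (C ((n : ℝ) * (n + s)) * y) := by
    rw [← h]; ring
  have hc := congrArg (fun p => p.coeff y.natDegree) h'
  have z1 : y.coeff (y.natDegree + 1) = 0 := coeff_eq_zero_of_natDegree_lt (by omega)
  have z2 : y.coeff (y.natDegree + 1 + 1) = 0 := coeff_eq_zero_of_natDegree_lt (by omega)
  -- Comparing leading coefficients gives `m(m+s) = n(n+s)`, i.e. `(m-n)(m+n+s) = 0`, and `m+n+s >
  -- 0` once `m ≠ n`.
  have key : (y.natDegree : ℝ) * (y.natDegree + s) = n * (n + s) := by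
    have hl : y.coeff y.natDegree ≠ 0 := by simpa using hy
    generalize y.natDegree = m at *
    apply mul_right_cancel₀ hl
    rcases m with _ | _ | k
    · simp only [coeff_add, coeff_sub, coeff_neg, coeff_C_mul, coeff_X_mul_zero,
        coeff_derivative, z1, z2] at hc
      push_cast
      linear_combination -hc
    · simp only [coeff_add, coeff_sub, coeff_neg, coeff_C_mul, coeff_X_mul, coeff_X_mul_zero,
        coeff_derivative, z1, z2] at hc
      push_cast at hc ⊢
      linear_combination -hc
    · simp only [coeff_add, coeff_sub, coeff_neg, coeff_C_mul, coeff_X_mul,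
        coeff_derivative, z1, z2] at hc
      push_cast at hc ⊢
      linear_combination -hc
  by_contra hne
  have h1 : ((y.natDegree : ℝ) - n) * (y.natDegree + n + s) = 0 := by linear_combination key
  rcases mul_eq_zero.1 h1 with h2 | h2
  · exact hne (by exact_mod_cast sub_eq_zero.1 h2)
  · have : 1 ≤ y.natDegree + n := by omega
    have : (1 : ℝ) ≤ y.natDegree + n := by exact_mod_cast this
    linarith

/-- The reflection formula for Jacobi polynomials. -/
theorem jacobi_comp_neg_X {a b : ℝ} (hab : -2 < a + b) (n : ℕ) :
    (jacobi a b n).comp (-X) = C ((-1) ^ n) * jacobi b a n := by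
  have hba : -2 < b + a := by linarith
  -- Both sides solve the same equation and have the same coefficient in degree `n`; a nonzero
  -- difference would have degree exactly `n`, yet its coefficient there is zero.
  rw [← sub_eq_zero]
  by_contra hne
  set p := (jacobi a b n).comp (-X) with hp
  set q := C ((-1) ^ n) * jacobi b a n with hq
  have hpo := congrArg (fun p => p.comp (-X)) (jacobi_ode a b n)
  simp only [add_comp, mul_comp, X_comp, one_comp, C_comp, sub_comp, neg_comp, pow_comp] at hpo
  have hp1 : derivative p = - (derivative (jacobi a b n)).comp (-X) := by
    simp [hp, derivative_comp]
  have hp2 : derivative (derivative p) = (derivative (derivative (jacobi a b n))).comp (-X) := by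
    simp [hp1, derivative_comp]
  have hode : (1 - X ^ 2) * derivative (derivative (p - q)) +
      (C (a - b) - C (b + a + 1 + 1) * X) * derivative (p - q) =
      - (C ((n : ℝ) * (n + (b + a + 1))) * (p - q)) := by
    have hqo := jacobi_ode b a n
    rw [derivative_sub, derivative_sub, hp2, hp1, hq, derivative_C_mul, derivative_C_mul]
    simp only [C_sub, C_add, C_mul, C_ofNat, C_1] at hpo hqo ⊢
    linear_combination hpo - C ((-1) ^ n) * hqo
  have hdeg := natDegree_of_jacobi_ode (by linarith) hne hode
  have hpd : p.natDegree = n := by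
    rw [hp, natDegree_comp, jacobi_natDegree hab, natDegree_neg, natDegree_X, mul_one]
  have hpl : p.coeff n = (-1) ^ n * (jacobiCoeff a b n n * (1 / 2) ^ n) := by
    have : p.leadingCoeff =
        (jacobi a b n).leadingCoeff * (-X : ℝ[X]).leadingCoeff ^ (jacobi a b n).natDegree := by
      rw [hp]; exact leadingCoeff_comp (by rw [natDegree_neg, natDegree_X]; norm_num)
    rw [leadingCoeff, hpd] at this
    rw [this, jacobi_leadingCoeff hab, leadingCoeff_neg, leadingCoeff_X, jacobi_natDegree hab]
    ring
  have hql : q.coeff n = (-1) ^ n * (jacobiCoeff b a n n * (1 / 2) ^ n) := by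
    rw [hq, coeff_C_mul, ← jacobi_leadingCoeff hba, leadingCoeff, jacobi_natDegree hba]
  have hz : (p - q).coeff n = 0 := by
    rw [coeff_sub, hpl, hql]
    simp only [jacobiCoeff, Nat.sub_self, ascPochhammer_zero, eval_one, add_right_comm _ a b]
    ring
  rw [← hdeg] at hz
  exact hne (by simpa using hz)

/-! ### The Jacobi weight: orthogonality, norms, expansions -/

open MeasureTheory in
theorem intervalIntegrable_jacobiWeight {a b : ℝ} (ha : -1 < a) (hb : -1 < b) :
    IntervalIntegrable (jacobiWeight a b) volume (-1) 1 := by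
  have h1 : IntervalIntegrable (jacobiWeight a b) volume (-1) 0 := by
    have h := (intervalIntegral.intervalIntegrable_rpow' (a := 0) (b := 1) hb).comp_add_left 1
    norm_num at h
    refine h.continuousOn_mul (g := fun x => (1 - x) ^ a) ?_
    refine ContinuousOn.rpow_const (by fun_prop) fun x hx => Or.inl ?_
    rw [Set.uIcc_of_le (by norm_num)] at hx
    linarith [hx.2]
  have h2 : IntervalIntegrable (jacobiWeight a b) volume 0 1 := by
    have h := (intervalIntegral.intervalIntegrable_rpow' (a := 0) (b := 1) ha).comp_sub_left 1
    norm_num at h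
    refine h.symm.mul_continuousOn (g := fun x => (1 + x) ^ b) ?_
    refine ContinuousOn.rpow_const (by fun_prop) fun x hx => Or.inl ?_
    rw [Set.uIcc_of_le (by norm_num)] at hx
    linarith [hx.1]
  exact h1.trans h2

theorem intervalIntegrable_eval_mul_jacobiWeight {a b : ℝ} (ha : -1 < a) (hb : -1 < b)
    (p : ℝ[X]) :
    IntervalIntegrable (fun x => p.eval x * jacobiWeight a b x) MeasureTheory.volume (-1) 1 :=
  (intervalIntegrable_jacobiWeight ha hb).continuousOn_mul p.continuous.continuousOn

/-- Euler's beta integral. It serves twice: for the mass of the weight and for the fractional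
integral of `(1+y)^k`. -/
theorem integral_rpow_mul_sub_rpow {p q L : ℝ} (hp : -1 < p) (hq : -1 < q) (hL : 0 < L) :
    ∫ x in (0 : ℝ)..L, x ^ p * (L - x) ^ q =
      L ^ (p + q + 1) * (Real.Gamma (p + 1) * Real.Gamma (q + 1) / Real.Gamma (p + q + 2)) := by
  have h := Complex.betaIntegral_scaled ((p + 1 : ℝ) : ℂ) ((q + 1 : ℝ) : ℂ) hL
  rw [Complex.betaIntegral_eq_Gamma_mul_div _ _ (by rw [Complex.ofReal_re]; linarith)
    (by rw [Complex.ofReal_re]; linarith)] at h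
  rw [← Complex.ofReal_inj, ← intervalIntegral.integral_ofReal]
  have e1 : ((p + 1 : ℝ) : ℂ) + ((q + 1 : ℝ) : ℂ) = ((p + q + 2 : ℝ) : ℂ) := by
    push_cast; ring
  have e2 : ((p + q + 2 : ℝ) : ℂ) - 1 = ((p + q + 1 : ℝ) : ℂ) := by push_cast; ring
  have e3 : ((p + 1 : ℝ) : ℂ) - 1 = (p : ℂ) := by push_cast; ring
  have e4 : ((q + 1 : ℝ) : ℂ) - 1 = (q : ℂ) := by push_cast; ring
  rw [e1, e2, e3, e4, Complex.Gamma_ofReal, Complex.Gamma_ofReal, Complex.Gamma_ofReal,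
    ← Complex.ofReal_cpow hL.le] at h
  push_cast [← h]
  refine intervalIntegral.integral_congr_Ioo_of_le hL.le fun x hx => ?_
  rw [Complex.ofReal_cpow hx.1.le, Complex.ofReal_cpow (sub_nonneg.2 hx.2.le),
    Complex.ofReal_sub]

theorem integral_jacobiWeight {a b : ℝ} (ha : -1 < a) (hb : -1 < b) :
    ∫ x in (-1 : ℝ)..1, jacobiWeight a b x = jacobiGamma a b 0 := by
  have h := intervalIntegral.integral_comp_add_left (a := -1) (b := 1)
    (fun y : ℝ => y ^ b * (2 - y) ^ a) 1
  have e : (1 : ℝ) + 1 = 2 := by norm_num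
  rw [add_neg_cancel, e, integral_rpow_mul_sub_rpow hb ha two_pos] at h
  simp only [jacobiGamma, if_true]
  rw [show ∫ x in (-1 : ℝ)..1, jacobiWeight a b x =
    ∫ x in (-1 : ℝ)..1, (1 + x) ^ b * (2 - (1 + x)) ^ a from ?_, h]
  · rw [add_comm b a]; ring
  · congr 1
    ext x
    rw [jacobiWeight, mul_comm]
    congr 2
    ring

/-- Integration of polynomials against the Jacobi weight, as a linear functional. -/
noncomputable def jacobiInt {a b : ℝ} (ha : -1 < a) (hb : -1 < b) : ℝ[X] →ₗ[ℝ] ℝ where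
  toFun p := ∫ x in (-1 : ℝ)..1, p.eval x * jacobiWeight a b x
  map_add' p q := by
    simp only [eval_add, add_mul]
    exact intervalIntegral.integral_add (intervalIntegrable_eval_mul_jacobiWeight ha hb p)
      (intervalIntegrable_eval_mul_jacobiWeight ha hb q)
  map_smul' c p := by
    simp only [eval_smul, smul_eq_mul, mul_assoc, RingHom.id_apply]
    exact intervalIntegral.integral_const_mul _ _

section

variable {a b : ℝ} (ha : -1 < a) (hb : -1 < b)

theorem jacobiInt_apply (p : ℝ[X]) :
    jacobiInt ha hb p = ∫ x in (-1 : ℝ)..1, p.eval x * jacobiWeight a b x := rfl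

theorem jacobiInt_C_mul (c : ℝ) (p : ℝ[X]) :
    jacobiInt ha hb (C c * p) = c * jacobiInt ha hb p := by
  rw [← smul_eq_C_mul, map_smul, smul_eq_mul]

/-- The integrand is nonnegative and vanishes in the open interval only at the finitely many zeros
of `p`. -/
theorem jacobiInt_pos {p : ℝ[X]} (hp : p ≠ 0) (h : ∀ x ∈ Set.Ioo (-1 : ℝ) 1, 0 ≤ p.eval x) :
    0 < jacobiInt ha hb p := by
  have hw : ∀ x ∈ Set.Ioo (-1 : ℝ) 1, 0 < jacobiWeight a b x := fun x hx =>
    mul_pos (Real.rpow_pos_of_pos (by linarith [hx.2]) _)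
      (Real.rpow_pos_of_pos (by linarith [hx.1]) _)
  rw [jacobiInt_apply, intervalIntegral.integral_pos_iff_support_of_nonneg_ae' _
    (intervalIntegrable_eval_mul_jacobiWeight ha hb p)]
  · refine ⟨by norm_num, ?_⟩
    have hsub : Set.Ioo (-1 : ℝ) 1 \ (p.roots.toFinset : Set ℝ) ⊆
        Function.support (fun x => p.eval x * jacobiWeight a b x) ∩ Set.Ioc (-1) 1 := by
      rintro x ⟨hx, hr⟩
      refine ⟨mul_ne_zero (fun h0 => hr ?_) (hw x hx).ne', hx.1, hx.2.le⟩
      simpa [hp] using h0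
    refine lt_of_lt_of_le ?_ (MeasureTheory.measure_mono hsub)
    rw [MeasureTheory.measure_sdiff_null (Finset.measure_zero _ _)]
    simp
  · rw [Set.uIoc_of_le (by norm_num), MeasureTheory.restrict_Ioo_eq_restrict_Ioc.symm]
    refine (MeasureTheory.ae_restrict_iff' measurableSet_Ioo).2 (.of_forall fun x hx => ?_)
    exact mul_nonneg (h x hx) (hw x hx).le

/-- Integration by parts against the Jacobi weight. -/
theorem jacobiInt_parts (g : ℝ[X]) :
    jacobiInt ha hb ((1 - X ^ 2) * derivative g + (C (b - a) - C (a + b + 2) * X) * g) = 0 := by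
  have h := intervalIntegral.integral_eq_sub_of_hasDerivAt_of_le (a := -1) (b := 1)
    -- This primitive vanishes at both endpoints because `a+1` and `b+1` are positive.
    (f := fun x => (1 - x) ^ (a + 1) * (1 + x) ^ (b + 1) * g.eval x)
    (f' := fun x => ((1 - X ^ 2) * derivative g + (C (b - a) - C (a + b + 2) * X) * g).eval x *
      jacobiWeight a b x) (by norm_num) ?_ ?_ (intervalIntegrable_eval_mul_jacobiWeight ha hb _)
  · rw [jacobiInt_apply, h]
    have h1 : a + 1 ≠ 0 := by linarith
    have h2 : b + 1 ≠ 0 := by linarith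
    simp [Real.zero_rpow h1, Real.zero_rpow h2]
  · refine ((ContinuousOn.rpow_const (by fun_prop) fun x _ => Or.inr (by linarith)).mul
      (ContinuousOn.rpow_const (by fun_prop) fun x _ => Or.inr (by linarith))).mul
      g.continuous.continuousOn
  · intro x hx
    have hx1 : 0 < 1 - x := by linarith [hx.2]
    have hx2 : 0 < 1 + x := by linarith [hx.1]
    have d1 := ((hasDerivAt_id x).const_sub 1).rpow_const (p := a + 1) (Or.inl hx1.ne')
    have d2 := ((hasDerivAt_id x).const_add 1).rpow_const (p := b + 1) (Or.inl hx2.ne')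
    refine ((d1.mul d2).mul (g.hasDerivAt x)).congr_deriv ?_
    simp only [id, add_sub_cancel_right, Pi.mul_apply]
    rw [Real.rpow_add_one hx1.ne', Real.rpow_add_one hx2.ne', jacobiWeight]
    simp only [eval_add, eval_sub, eval_mul, eval_one, eval_pow, eval_X, eval_C]
    ring

/-- The weak form of the differential equation: integrate by parts with `g = P_n' F`. Symmetry in
two indices yields orthogonality, and `F = P_n` yields the norms. -/
theorem jacobiInt_derivative_mul_derivative (n : ℕ) (F : ℝ[X]) :
    jacobiInt ha hb ((1 - X ^ 2) * derivative (jacobi a b n) * derivative F) =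
      n * (n + a + b + 1) * jacobiInt ha hb (jacobi a b n * F) := by
  have h := jacobiInt_parts ha hb (derivative (jacobi a b n) * F)
  have e : (1 - X ^ 2) * derivative (derivative (jacobi a b n) * F) +
      (C (b - a) - C (a + b + 2) * X) * (derivative (jacobi a b n) * F) =
      (1 - X ^ 2) * derivative (jacobi a b n) * derivative F -
        C (n * (n + a + b + 1)) * (jacobi a b n * F) := by
    rw [derivative_mul]
    linear_combination F * jacobi_ode a b n
  rw [e, map_sub, jacobiInt_C_mul] at h
  linarith

theorem jacobiInt_mul_of_ne {n m : ℕ} (h : n ≠ m) :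
    jacobiInt ha hb (jacobi a b n * jacobi a b m) = 0 := by
  have h1 := jacobiInt_derivative_mul_derivative ha hb n (jacobi a b m)
  have h2 := jacobiInt_derivative_mul_derivative ha hb m (jacobi a b n)
  rw [mul_right_comm, mul_comm (jacobi a b m)] at h2
  have h3 : ((n : ℝ) - m) * ((n + m + a + b + 1) *
      jacobiInt ha hb (jacobi a b n * jacobi a b m)) = 0 := by
    linear_combination h2 - h1
  have hnm : (n : ℝ) - m ≠ 0 := sub_ne_zero.2 (by exact_mod_cast h)
  have : (1 : ℝ) ≤ n + m := by exact_mod_cast (by omega : 1 ≤ n + m)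
  have : (n : ℝ) + m + a + b + 1 ≠ 0 := by linarith
  simpa [hnm, this] using h3

theorem jacobiInt_one_sub_X_sq_mul (F : ℝ[X]) :
    jacobiInt ha hb ((1 - X ^ 2) * F) =
      jacobiInt (a := a + 1) (b := b + 1) (by linarith) (by linarith) F := by
  simp only [jacobiInt_apply]
  refine intervalIntegral.integral_congr_Ioo_of_le (by norm_num) fun x hx => ?_
  have hx1 : 0 < 1 - x := by linarith [hx.2]
  have hx2 : 0 < 1 + x := by linarith [hx.1]
  simp only [jacobiWeight, eval_mul, eval_sub, eval_one, eval_pow, eval_X]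
  rw [Real.rpow_add_one hx1.ne', Real.rpow_add_one hx2.ne']
  ring

include ha hb in
-- The recursion that the squared norms must satisfy, since `P_{n+1}'` is `(n+a+b+2)/2` times
-- `P_n^{(a+1,b+1)}`. The case `n = 0` is separate because of the special branch of `jacobiGamma`.
theorem jacobiGamma_succ (n : ℕ) :
    (n + 1 : ℝ) * (n + a + b + 2) * jacobiGamma a b (n + 1) =
      ((n + a + b + 2) / 2) ^ 2 * jacobiGamma (a + 1) (b + 1) n := by
  have e2 : (2 : ℝ) ^ (a + 1 + (b + 1) + 1) = 4 * 2 ^ (a + b + 1) := by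
    rw [show a + 1 + (b + 1) + 1 = a + b + 1 + 2 by ring, Real.rpow_add two_pos]
    norm_num
    ring
  rcases n with _ | n
  · simp only [jacobiGamma, zero_add, one_ne_zero, if_true, if_false]
    have g1 : Real.Gamma (a + 1 + (b + 1) + 2) = (a + b + 3) * ((a + b + 2) *
        Real.Gamma (a + b + 2)) := by
      rw [← Real.Gamma_add_one (by linarith), show a + 1 + (b + 1) + 2 = a + b + 3 + 1 by ring,
        Real.Gamma_add_one (by linarith)]
      congr 2; ring
    have hG : Real.Gamma (a + b + 2) ≠ 0 := (Real.Gamma_pos_of_pos (by linarith)).ne'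
    have h2 : a + b + 2 ≠ 0 := by linarith
    have h3 : a + b + 3 ≠ 0 := by linarith
    rw [e2, g1]
    push_cast
    rw [show (1 : ℝ) + a + 1 = a + 1 + 1 by ring, show (1 : ℝ) + b + 1 = b + 1 + 1 by ring,
      show (1 : ℝ) + a + b + 1 = a + b + 2 by ring, show 2 * (1 : ℝ) + a + b + 1 = a + b + 3 by ring,
      show (0 : ℝ) + a + b + 2 = a + b + 2 by ring]
    simp only [Nat.factorial_one, Nat.cast_one]
    field_simp
    ring
  · have hn : (0 : ℝ) ≤ n := n.cast_nonneg
    simp only [jacobiGamma, Nat.add_eq_zero_iff, one_ne_zero, and_false, if_false]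
    push_cast [Nat.factorial_succ]
    rw [show (n : ℝ) + 1 + 1 + a + 1 = n + 1 + (a + 1) + 1 by ring,
      show (n : ℝ) + 1 + 1 + b + 1 = n + 1 + (b + 1) + 1 by ring,
      show (n : ℝ) + 1 + (a + 1) + (b + 1) + 1 = (n + 1 + 1 + a + b + 1) + 1 by ring,
      Real.Gamma_add_one (s := (n : ℝ) + 1 + 1 + a + b + 1) (by linarith), e2]
    have hG : Real.Gamma ((n : ℝ) + 1 + 1 + a + b + 1) ≠ 0 :=
      (Real.Gamma_pos_of_pos (by linarith)).ne'
    have h2 : (n : ℝ) + 1 + a + b + 2 ≠ 0 := by linarith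
    have h3 : 2 * ((n : ℝ) + 1 + 1) + a + b + 1 ≠ 0 := by linarith
    rw [show (n : ℝ) + 1 + 1 + a + b + 1 = n + 1 + a + b + 2 by ring] at hG ⊢
    rw [show 2 * ((n : ℝ) + 1) + (a + 1) + (b + 1) + 1 = 2 * ((n : ℝ) + 1 + 1) + a + b + 1 by ring]
    have : (n.factorial : ℝ) ≠ 0 := by positivity
    field_simp
    ring

theorem jacobiInt_mul_self (n : ℕ) :
    jacobiInt ha hb (jacobi a b n * jacobi a b n) = jacobiGamma a b n := by
  -- Each step lowers the degree but raises both parameters by one.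
  induction n generalizing a b with
  | zero =>
    rw [jacobi_zero, jacobiInt_apply, ← integral_jacobiWeight ha hb]
    simp
  | succ n ih =>
    have hn : (0 : ℝ) ≤ n := n.cast_nonneg
    have h := jacobiInt_derivative_mul_derivative ha hb (n + 1) (jacobi a b (n + 1))
    rw [jacobi_succ_derivative, mul_assoc, jacobiInt_one_sub_X_sq_mul, mul_mul_mul_comm, ← C_mul,
      jacobiInt_C_mul, ih] at h
    have h' := jacobiGamma_succ ha hb n
    push_cast at h
    have h1 : (n : ℝ) + 1 ≠ 0 := by linarith
    have h2 : (n : ℝ) + a + b + 2 ≠ 0 := by linarith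
    apply mul_left_cancel₀ (mul_ne_zero h1 h2)
    linear_combination -h' - h

include ha hb in
theorem jacobiGamma_pos (n : ℕ) : 0 < jacobiGamma a b n := by
  rw [← jacobiInt_mul_self ha hb]
  refine jacobiInt_pos ha hb ?_ fun x _ => ?_
  · exact mul_self_ne_zero.2 (jacobi_ne_zero (by linarith) n)
  · rw [eval_mul]; exact mul_self_nonneg _

include ha hb in
theorem exists_eq_sum_jacobi (n : ℕ) {f : ℝ[X]} (hf : f.natDegree ≤ n) :
    ∃ c : ℕ → ℝ, f = ∑ l ∈ Finset.range (n + 1), C (c l) * jacobi a b l := by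
  have hab : -2 < a + b := by linarith
  induction n generalizing f with
  | zero =>
    refine ⟨fun _ => f.coeff 0, ?_⟩
    simpa [jacobi_zero] using eq_C_of_natDegree_le_zero hf
  | succ n ih =>
    have hl : (jacobi a b (n + 1)).coeff (n + 1) ≠ 0 := by
      have := jacobi_natDegree hab (n + 1)
      have h0 := leadingCoeff_ne_zero.2 (jacobi_ne_zero hab (n + 1))
      rwa [leadingCoeff, this] at h0
    set t := f.coeff (n + 1) / (jacobi a b (n + 1)).coeff (n + 1) with ht
    obtain ⟨c, hc⟩ := ih (f := f - C t * jacobi a b (n + 1)) (by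
      rw [natDegree_le_iff_coeff_eq_zero]
      intro k hk
      rcases (Nat.succ_le_of_lt hk).eq_or_lt with h | h
      · rw [← h, coeff_sub, coeff_C_mul, ht]
        field_simp
        simp
      · rw [coeff_sub, coeff_C_mul, coeff_eq_zero_of_natDegree_lt (lt_of_le_of_lt hf h),
          coeff_eq_zero_of_natDegree_lt ((jacobi_natDegree hab (n + 1)).trans_lt h)]
        simp)
    refine ⟨fun l => if l = n + 1 then t else c l, ?_⟩
    simp only [Finset.sum_range_succ, if_true]
    rw [← sub_eq_iff_eq_add, hc, ← Finset.sum_range_succ]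
    refine Finset.sum_congr rfl fun l hl => ?_
    rw [if_neg (by have := Finset.mem_range.1 hl; omega)]

/-- The expansion of a polynomial in Jacobi polynomials. -/
theorem eq_sum_jacobi {n : ℕ} {f : ℝ[X]} (hf : f.natDegree ≤ n) :
    f = ∑ l ∈ Finset.range (n + 1),
      C (1 / jacobiGamma a b l * jacobiInt ha hb (jacobi a b l * f)) * jacobi a b l := by
  obtain ⟨c, hc⟩ := exists_eq_sum_jacobi ha hb n hf
  conv_lhs => rw [hc]
  refine Finset.sum_congr rfl fun l hl => ?_
  congr 2
  have : jacobiInt ha hb (jacobi a b l * f) = c l * jacobiGamma a b l := by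
    rw [hc, Finset.mul_sum, map_sum, Finset.sum_eq_single l]
    · rw [mul_left_comm, jacobiInt_C_mul, jacobiInt_mul_self]
    · intro k _ hk
      rw [mul_left_comm, jacobiInt_C_mul, jacobiInt_mul_of_ne ha hb hk.symm, mul_zero]
    · exact fun h => absurd hl h
  rw [this]
  have := (jacobiGamma_pos ha hb l).ne'
  field_simp

theorem jacobiInt_jacobi_mul_of_natDegree_lt {n : ℕ} {f : ℝ[X]} (hf : f.natDegree < n) :
    jacobiInt ha hb (jacobi a b n * f) = 0 := by
  obtain ⟨c, hc⟩ := exists_eq_sum_jacobi ha hb (n - 1) (f := f) (by omega)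
  rw [hc, Finset.mul_sum, map_sum]
  refine Finset.sum_eq_zero fun k hk => ?_
  have := Finset.mem_range.1 hk
  rw [mul_left_comm, jacobiInt_C_mul, jacobiInt_mul_of_ne ha hb (by omega), mul_zero]

end

/-! ### Zeros of Jacobi polynomials -/

section

variable {a b : ℝ} (ha : -1 < a) (hb : -1 < b)

include ha hb in
/-- Nonconstant divisors of Jacobi polynomials take negative values on `(-1,1)`. -/
theorem exists_eval_neg_of_dvd_jacobi {n : ℕ} {d : ℝ[X]} (hd : d ∣ jacobi a b n)
    (hdeg : 0 < d.natDegree) : ∃ x ∈ Set.Ioo (-1 : ℝ) 1, d.eval x < 0 := by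
  by_contra! hpos
  obtain ⟨g, hg⟩ := hd
  have hp := jacobi_ne_zero (a := a) (b := b) (by linarith) n
  have hd0 : d ≠ 0 := fun h => hp (by rw [hg, h, zero_mul])
  have hg0 : g ≠ 0 := fun h => hp (by rw [hg, h, mul_zero])
  have hn : d.natDegree + g.natDegree = n := by
    rw [← natDegree_mul hd0 hg0, ← hg, jacobi_natDegree (by linarith)]
  -- With `P_n = d g` and `deg g < n`, orthogonality gives `∫ d g² w = 0`, impossible if `d ≥ 0` on
  -- the interval.
  have h0 := jacobiInt_jacobi_mul_of_natDegree_lt ha hb (n := n) (f := g) (by omega)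
  rw [hg] at h0
  refine (jacobiInt_pos ha hb (mul_ne_zero (mul_ne_zero hd0 hg0) hg0) fun x hx => ?_).ne' h0
  rw [eval_mul, eval_mul, mul_assoc]
  exact mul_nonneg (hpos x hx) (mul_self_nonneg _)

include ha hb in
-- Both `d` and `-d` take negative values, so `d` changes sign. Applied to linear factors, this
-- locates the real roots; applied to the cofactor free of real roots, it shows that there are `n`
-- of them.
theorem exists_eval_eq_zero_of_dvd_jacobi {n : ℕ} {d : ℝ[X]} (hd : d ∣ jacobi a b n)
    (hdeg : 0 < d.natDegree) : ∃ x ∈ Set.Ioo (-1 : ℝ) 1, d.eval x = 0 := by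
  obtain ⟨x, hx, hx0⟩ := exists_eval_neg_of_dvd_jacobi ha hb hd hdeg
  obtain ⟨y, hy, hy0⟩ := exists_eval_neg_of_dvd_jacobi ha hb ((neg_dvd).2 hd)
    (by rwa [natDegree_neg])
  rw [eval_neg, neg_lt_zero] at hy0
  exact isPreconnected_Ioo.intermediate_value hx hy d.continuous.continuousOn ⟨hx0.le, hy0.le⟩

include ha hb in
theorem mem_Ioo_of_mem_roots_jacobi {n : ℕ} {r : ℝ} (hr : r ∈ (jacobi a b n).roots) :
    r ∈ Set.Ioo (-1 : ℝ) 1 := by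
  have hr' := dvd_iff_isRoot.2 (isRoot_of_mem_roots hr)
  obtain ⟨x, hx, hx0⟩ := exists_eval_eq_zero_of_dvd_jacobi ha hb hr' (by simp)
  have : x = r := by simpa [sub_eq_zero] using hx0
  exact this ▸ hx

include ha hb in
theorem jacobi_roots_nodup (n : ℕ) : (jacobi a b n).roots.Nodup := by
  rw [Multiset.nodup_iff_count_le_one]
  intro r
  by_contra! h
  rw [count_roots] at h
  have h2 := (le_rootMultiplicity_iff (jacobi_ne_zero (by linarith) n)).1 (Nat.succ_le_of_lt h)
  -- A double root would make the square `(X-r)²` a divisor, which is never negative.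
  obtain ⟨x, -, hx⟩ := exists_eval_neg_of_dvd_jacobi ha hb h2 (by simp)
  rw [eval_pow] at hx
  exact absurd hx (not_lt.2 (sq_nonneg _))

include ha hb in
theorem jacobi_card_roots (n : ℕ) : (jacobi a b n).roots.card = n := by
  obtain ⟨q, hq, hcard, hroots⟩ := exists_prod_multiset_X_sub_C_mul (jacobi a b n)
  rw [jacobi_natDegree (by linarith)] at hcard
  rcases Nat.eq_zero_or_pos q.natDegree with h | h
  · omega
  · obtain ⟨x, -, hx⟩ := exists_eval_eq_zero_of_dvd_jacobi ha hb (Dvd.intro_left _ hq) h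
    have hq0 : q ≠ 0 := by rintro rfl; simp at h
    have : x ∈ q.roots := (mem_roots hq0).2 hx
    simp [hroots] at this

end

/-! ### The Jacobi–Gauss–Lobatto points -/

/-- The polynomial whose zeros are the Jacobi-Gauss-Lobatto points. -/
noncomputable def jglPoly (a b : ℝ) (N : ℕ) : ℝ[X] :=
  (1 - X ^ 2) * derivative (jacobi a b N)

section

variable {a b : ℝ} (ha : -1 < a) (hb : -1 < b)

theorem jglPoly_succ (a b : ℝ) (M : ℕ) : jglPoly a b (M + 1) =
    C (-((M + a + b + 2) / 2)) *
      ((X - C 1) * ((X - C (-1)) * jacobi (a + 1) (b + 1) M)) := by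
  rw [jglPoly, jacobi_succ_derivative]
  simp only [C_neg, C_1]
  ring

include ha hb

theorem jglPoly_succ_const_ne_zero (M : ℕ) : -(((M : ℝ) + a + b + 2) / 2) ≠ 0 := by
  have : (0 : ℝ) ≤ M := M.cast_nonneg
  have : 0 < ((M : ℝ) + a + b + 2) / 2 := by linarith
  linarith

theorem jglPoly_natDegree (M : ℕ) : (jglPoly a b (M + 1)).natDegree = M + 2 := by
  have h0 : jacobi (a + 1) (b + 1) M ≠ 0 := jacobi_ne_zero (by linarith) M
  rw [jglPoly_succ, natDegree_C_mul (jglPoly_succ_const_ne_zero ha hb M),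
    natDegree_mul (X_sub_C_ne_zero 1) (mul_ne_zero (X_sub_C_ne_zero _) h0),
    natDegree_mul (X_sub_C_ne_zero _) h0, natDegree_X_sub_C, natDegree_X_sub_C,
    jacobi_natDegree (by linarith)]
  omega

theorem jglPoly_roots (M : ℕ) :
    (jglPoly a b (M + 1)).roots = {1} + ({-1} + (jacobi (a + 1) (b + 1) M).roots) := by
  have h0 : jacobi (a + 1) (b + 1) M ≠ 0 := jacobi_ne_zero (by linarith) M
  have h1 := mul_ne_zero (X_sub_C_ne_zero (-1 : ℝ)) h0
  rw [jglPoly_succ, roots_C_mul _ (jglPoly_succ_const_ne_zero ha hb M),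
    roots_mul (mul_ne_zero (X_sub_C_ne_zero _) h1), roots_mul h1, roots_X_sub_C, roots_X_sub_C]

theorem jglPoly_roots_nodup (M : ℕ) : (jglPoly a b (M + 1)).roots.Nodup := by
  have hm := fun r => mem_Ioo_of_mem_roots_jacobi (a := a + 1) (b := b + 1) (n := M) (r := r)
    (by linarith) (by linarith)
  rw [jglPoly_roots ha hb, Multiset.singleton_add, Multiset.singleton_add, Multiset.nodup_cons,
    Multiset.nodup_cons]
  refine ⟨fun h => ?_, fun h => ?_, jacobi_roots_nodup (by linarith) (by linarith) M⟩
  · rcases Multiset.mem_cons.1 h with h | h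
    · norm_num at h
    · exact absurd (hm _ h).2 (lt_irrefl _)
  · exact absurd (hm _ h).1 (lt_irrefl _)

theorem length_sort_jglPoly_roots (M : ℕ) :
    ((jglPoly a b (M + 1)).roots.toFinset.sort (· ≤ ·)).length = M + 2 := by
  rw [Finset.length_sort, Multiset.toFinset_card_of_nodup (jglPoly_roots_nodup ha hb M),
    jglPoly_roots ha hb]
  simp only [Multiset.card_add, Multiset.card_singleton]
  rw [jacobi_card_roots (by linarith) (by linarith)]
  omega

/-- The list of zeros has length `N+1 = M+2`, so the default value in `jglNode` is never used for
these `j`. -/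
theorem jglNode_eq_getElem {M j : ℕ} (hj : j < M + 2) :
    jglNode a b (M + 1) j = ((jglPoly a b (M + 1)).roots.toFinset.sort (· ≤ ·))[j]'(by
      rwa [length_sort_jglPoly_roots ha hb]) :=
  (List.getElem_eq_getD _).symm

theorem jglNode_mem_roots {M j : ℕ} (hj : j < M + 2) :
    jglNode a b (M + 1) j ∈ (jglPoly a b (M + 1)).roots := by
  rw [jglNode_eq_getElem ha hb hj, ← Multiset.mem_toFinset]
  exact (Finset.mem_sort _).1 (List.getElem_mem _)

theorem jglNode_lt {M i j : ℕ} (hij : i < j) (hj : j < M + 2) :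
    jglNode a b (M + 1) i < jglNode a b (M + 1) j := by
  rw [jglNode_eq_getElem ha hb hj, jglNode_eq_getElem ha hb (hij.trans hj)]
  exact (Finset.sortedLT_sort _).getElem_lt_getElem_of_lt hij

theorem jglNode_injOn (M : ℕ) :
    Set.InjOn (jglNode a b (M + 1)) (Finset.range (M + 1 + 1) : Set ℕ) := by
  intro i hi j hj h
  have hi' : i < M + 2 := Finset.mem_range.1 (Finset.mem_coe.1 hi)
  have hj' : j < M + 2 := Finset.mem_range.1 (Finset.mem_coe.1 hj)
  rcases lt_trichotomy i j with hij | hij | hij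
  · exact absurd h (jglNode_lt ha hb hij hj').ne
  · exact hij
  · exact absurd h (jglNode_lt ha hb hij hi').ne'

theorem mem_Icc_of_mem_roots_jglPoly {M : ℕ} {r : ℝ} (hr : r ∈ (jglPoly a b (M + 1)).roots) :
    r ∈ Set.Icc (-1 : ℝ) 1 := by
  rw [jglPoly_roots ha hb, Multiset.mem_add, Multiset.mem_add, Multiset.mem_singleton,
    Multiset.mem_singleton] at hr
  rcases hr with rfl | rfl | h
  · norm_num
  · norm_num
  · exact Set.Ioo_subset_Icc_self
      (mem_Ioo_of_mem_roots_jacobi (by linarith) (by linarith) h)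

theorem jglNode_zero (M : ℕ) : jglNode a b (M + 1) 0 = -1 := by
  apply le_antisymm
  · have h : (-1 : ℝ) ∈ (jglPoly a b (M + 1)).roots.toFinset.sort (· ≤ ·) := by
      rw [Finset.mem_sort, Multiset.mem_toFinset, jglPoly_roots ha hb]
      simp
    obtain ⟨i, hi, h⟩ := List.mem_iff_getElem.1 h
    rw [length_sort_jglPoly_roots ha hb] at hi
    rw [← jglNode_eq_getElem ha hb hi] at h
    rw [← h]
    rcases i.eq_zero_or_pos with rfl | hpos
    · exact le_rfl
    · exact (jglNode_lt ha hb hpos hi).le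
  · exact (mem_Icc_of_mem_roots_jglPoly ha hb (jglNode_mem_roots ha hb (by omega))).1

theorem neg_one_lt_jglNode {M i : ℕ} (hi : 0 < i) (hi' : i < M + 2) :
    -1 < jglNode a b (M + 1) i := by
  rw [← jglNode_zero ha hb M]
  exact jglNode_lt ha hb hi hi'

theorem jglPoly_eval_jglNode {M j : ℕ} (hj : j < M + 2) :
    (jglPoly a b (M + 1)).eval (jglNode a b (M + 1) j) = 0 :=
  isRoot_of_mem_roots (jglNode_mem_roots ha hb hj)

/-! ### Lobatto quadrature and expansion of the Lagrange basis -/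

theorem modByMonic_nodal_eq_interpolate (M : ℕ) (f : ℝ[X]) :
    f %ₘ Lagrange.nodal (Finset.range (M + 1 + 1)) (jglNode a b (M + 1)) =
      Lagrange.interpolate (Finset.range (M + 1 + 1)) (jglNode a b (M + 1))
        (fun i => f.eval (jglNode a b (M + 1) i)) := by
  have hm := Lagrange.nodal_monic (s := Finset.range (M + 1 + 1)) (v := jglNode a b (M + 1))
  refine Lagrange.eq_interpolate_of_eval_eq _ (jglNode_injOn ha hb M) ?_ fun i hi => ?_
  · exact (degree_modByMonic_lt f hm).trans_le Lagrange.degree_nodal.le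
  · conv_rhs => rw [← modByMonic_add_div f
      (q := Lagrange.nodal (Finset.range (M + 1 + 1)) (jglNode a b (M + 1)))]
    rw [eval_add, eval_mul, Lagrange.eval_nodal_at_node hi, zero_mul, add_zero]

theorem exists_jglPoly_eq (M : ℕ) : ∃ c : ℝ, c ≠ 0 ∧ jglPoly a b (M + 1) =
    C c * Lagrange.nodal (Finset.range (M + 1 + 1)) (jglNode a b (M + 1)) := by
  set v := Lagrange.nodal (Finset.range (M + 1 + 1)) (jglNode a b (M + 1)) with hv
  have h1 : jglPoly a b (M + 1) %ₘ v = 0 := by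
    rw [hv, modByMonic_nodal_eq_interpolate ha hb, Lagrange.interpolate_apply]
    refine Finset.sum_eq_zero fun i hi => ?_
    rw [jglPoly_eval_jglNode ha hb (Finset.mem_range.1 hi), C_0, zero_mul]
  have h2 := modByMonic_add_div (jglPoly a b (M + 1)) (q := v)
  rw [h1, zero_add] at h2
  have hvd : v.natDegree = M + 2 := by rw [hv, Lagrange.natDegree_nodal, Finset.card_range]
  have hW := jglPoly_natDegree ha hb M
  have hq : (jglPoly a b (M + 1) /ₘ v).natDegree = 0 := by
    rw [natDegree_divByMonic _ Lagrange.nodal_monic, hW, hvd, Nat.sub_self]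
  rw [eq_C_of_natDegree_eq_zero hq] at h2
  refine ⟨_, fun h0 => ?_, by rw [← h2, mul_comm]⟩
  rw [h0, C_0, mul_zero] at h2
  rw [← h2] at hW
  simp at hW

/-- The Jacobi-Gauss-Lobatto quadrature is exact up to degree `2N - 1`. -/
theorem jacobiInt_eq_sum_jglWeight (M : ℕ) {f : ℝ[X]} (hf : f.natDegree ≤ 2 * M + 1) :
    jacobiInt ha hb f = ∑ i ∈ Finset.range (M + 1 + 1),
      jglWeight a b (M + 1) i * f.eval (jglNode a b (M + 1) i) := by
  obtain ⟨c, hc, hW⟩ := exists_jglPoly_eq ha hb M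
  set v := Lagrange.nodal (Finset.range (M + 1 + 1)) (jglNode a b (M + 1)) with hv
  have hvd : v.natDegree = M + 2 := by rw [hv, Lagrange.natDegree_nodal, Finset.card_range]
  have hvm : v.Monic := Lagrange.nodal_monic
  -- Up to a constant, `v` is `(1-x²) P_M^{(a+1,b+1)}`; the factor `1-x²` shifts the weight, and the
  -- quotient has degree below `M`, or is zero. The zero case is separate because for `M = 0` its
  -- `natDegree` is not below `M`.
  have h0 : jacobiInt ha hb (v * (f /ₘ v)) = 0 := by
    have h1 : jacobiInt ha hb (jglPoly a b (M + 1) * (f /ₘ v)) = 0 := by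
      rw [jglPoly, jacobi_succ_derivative, mul_assoc, jacobiInt_one_sub_X_sq_mul, mul_assoc,
        jacobiInt_C_mul]
      rcases lt_or_ge f.natDegree (M + 2) with h | h
      · rw [(divByMonic_eq_zero_iff hvm).2 (degree_lt_degree (by rwa [hvd])), mul_zero, map_zero,
          mul_zero]
      · rw [jacobiInt_jacobi_mul_of_natDegree_lt, mul_zero]
        rw [natDegree_divByMonic _ hvm, hvd]
        omega
    rw [hW, mul_assoc, jacobiInt_C_mul] at h1
    exact (mul_eq_zero.1 h1).resolve_left hc
  conv_lhs => rw [← modByMonic_add_div f (q := v), map_add, h0, add_zero, hv,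
    modByMonic_nodal_eq_interpolate ha hb, Lagrange.interpolate_apply, map_sum]
  refine Finset.sum_congr rfl fun i _ => ?_
  rw [jacobiInt_C_mul, mul_comm]
  rfl

/-- `P_N²` has degree `2N`, one too many for exactness. Adding `(1-x²)P_N'²/N²` cancels the top
coefficient and changes no nodal value; its integral is `(1 + (a+b+1)/N) γ_N`, which explains the
modified constant. -/
theorem sum_jglWeight_mul_jacobi_sq (M : ℕ) :
    ∑ i ∈ Finset.range (M + 1 + 1), jglWeight a b (M + 1) i *
      ((jacobi a b (M + 1)).eval (jglNode a b (M + 1) i) *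
        (jacobi a b (M + 1)).eval (jglNode a b (M + 1) i)) =
      jacobiGammaTilde a b (M + 1) (M + 1) := by
  have hM : (M : ℝ) + 1 ≠ 0 := by positivity
  set P := jacobi a b (M + 1) with hP
  set f := P * P + C (1 / ((M : ℝ) + 1) ^ 2) * ((1 - X ^ 2) * derivative P * derivative P) with hf
  have hPd : P.natDegree = M + 1 := jacobi_natDegree (by linarith) _
  have hD : (derivative P).natDegree ≤ M := (natDegree_derivative_le P).trans (by omega)
  have h1 : (1 - X ^ 2 : ℝ[X]).natDegree ≤ 2 := by compute_degree
  have h1D : ((1 - X ^ 2) * derivative P).natDegree ≤ 2 + M :=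
    natDegree_mul_le_of_le h1 hD
  have hfd : f.natDegree ≤ 2 * M + 1 := by
    have h2 : f.natDegree ≤ 2 * M + 2 := by
      refine natDegree_add_le_of_degree_le ?_ ?_
      · exact (natDegree_mul_le_of_le hPd.le hPd.le).trans (by omega)
      · exact (natDegree_C_mul_le _ _).trans
          ((natDegree_mul_le_of_le h1D hD).trans (by omega))
    refine natDegree_le_iff_coeff_eq_zero.2 fun k hk => ?_
    rcases (Nat.succ_le_of_lt hk).eq_or_lt with h | h
    · have c1 : (P * P).coeff k = P.coeff (M + 1) * P.coeff (M + 1) := by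
        rw [← h, show (2 * M + 1).succ = (M + 1) + (M + 1) by omega]
        exact coeff_mul_add_eq_of_natDegree_le hPd.le hPd.le
      have c2 : ((1 - X ^ 2) * derivative P * derivative P).coeff k =
          (1 - X ^ 2 : ℝ[X]).coeff 2 * (derivative P).coeff M * (derivative P).coeff M := by
        rw [← h, show (2 * M + 1).succ = (2 + M) + M by omega,
          coeff_mul_add_eq_of_natDegree_le h1D hD, coeff_mul_add_eq_of_natDegree_le h1 hD]
      have c3 : (1 - X ^ 2 : ℝ[X]).coeff 2 = -1 := by
        simp [coeff_one]
      rw [hf, coeff_add, coeff_C_mul, c1, c2, c3, coeff_derivative]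
      field_simp
      ring
    · exact coeff_eq_zero_of_natDegree_lt (by omega)
  have key := jacobiInt_eq_sum_jglWeight ha hb M hfd
  have hI : jacobiInt ha hb f = jacobiGammaTilde a b (M + 1) (M + 1) := by
    rw [hf, map_add, jacobiInt_C_mul, hP, jacobiInt_derivative_mul_derivative,
      jacobiInt_mul_self, jacobiGammaTilde, if_pos rfl]
    push_cast
    field_simp
    ring
  rw [← hI, key]
  refine Finset.sum_congr rfl fun i hi => ?_
  have hz := jglPoly_eval_jglNode ha hb (M := M) (j := i) (Finset.mem_range.1 hi)
  rw [jglPoly, ← hP] at hz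
  rw [hf, eval_add, eval_mul, eval_mul, eval_mul (p := (1 - X ^ 2) * derivative P), hz]
  simp

theorem jglLagrange_natDegree {M j : ℕ} (hj : j < M + 2) :
    (jglLagrange a b (M + 1) j).natDegree = M + 1 := by
  rw [jglLagrange, Lagrange.natDegree_basis (jglNode_injOn ha hb M) (Finset.mem_range.2 hj),
    Finset.card_range, Nat.add_sub_cancel]

theorem jglLagrange_eval_jglNode {M i j : ℕ} (hi : i < M + 2) (hj : j < M + 2) :
    (jglLagrange a b (M + 1) j).eval (jglNode a b (M + 1) i) = if i = j then 1 else 0 := by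
  split_ifs with h
  · rw [h]; exact Lagrange.eval_basis_self (jglNode_injOn ha hb M) (Finset.mem_range.2 hj)
  · exact Lagrange.eval_basis_of_ne (Ne.symm h) (Finset.mem_range.2 hi)

theorem sum_jglWeight_mul_jglLagrange {M j : ℕ} (hj : j < M + 2) (p : ℝ[X]) :
    ∑ i ∈ Finset.range (M + 1 + 1), jglWeight a b (M + 1) i *
      (p * jglLagrange a b (M + 1) j).eval (jglNode a b (M + 1) i) =
      jglWeight a b (M + 1) j * p.eval (jglNode a b (M + 1) j) := by
  rw [Finset.sum_eq_single j]
  · rw [eval_mul, jglLagrange_eval_jglNode ha hb hj hj, if_pos rfl, mul_one]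
  · intro i hi hij
    rw [eval_mul, jglLagrange_eval_jglNode ha hb (Finset.mem_range.1 hi) hj, if_neg hij, mul_zero,
      mul_zero]
  · exact fun h => absurd (Finset.mem_range.2 hj) h

/-- The expansion of the Lagrange basis polynomials at the Jacobi-Gauss-Lobatto points. -/
theorem jglLagrange_eq_sum {M j : ℕ} (hj : j < M + 2) :
    jglLagrange a b (M + 1) j =
      ∑ n ∈ Finset.range (M + 1 + 1), C (tCoeff a b (M + 1) n j) * jacobi a b n := by
  set h := jglLagrange a b (M + 1) j with hh
  have hd : h.natDegree = M + 1 := jglLagrange_natDegree ha hb hj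
  have hexp := eq_sum_jacobi ha hb hd.le
  rw [Finset.sum_range_succ] at hexp
  conv_lhs => rw [hexp]
  conv_rhs => rw [Finset.sum_range_succ]
  -- In the top degree `P_N h_j` is beyond exactness. Write `h_j = c P_N + g` with `deg g < N`:
  -- quadrature is exact on `P_N g`, whose integral is `0`, so `ω_j P_N(x_j) = c γ̃_N`.
  have hN : (1 / jacobiGamma a b (M + 1) * jacobiInt ha hb (jacobi a b (M + 1) * h)) =
      tCoeff a b (M + 1) (M + 1) j := by
    set c := 1 / jacobiGamma a b (M + 1) * jacobiInt ha hb (jacobi a b (M + 1) * h) with hc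
    set P := jacobi a b (M + 1) with hP
    have hPd : P.natDegree = M + 1 := jacobi_natDegree (by linarith) _
    have hg : (h - C c * P).natDegree ≤ M := by
      rw [sub_eq_iff_eq_add.2 hexp]
      refine natDegree_sum_le_of_forall_le _ _ fun l hl => ?_
      refine (natDegree_C_mul_le _ _).trans ?_
      rw [jacobi_natDegree (by linarith)]
      have := Finset.mem_range.1 hl
      omega
    have hquad := jacobiInt_eq_sum_jglWeight ha hb M (f := P * (h - C c * P))
      ((natDegree_mul_le_of_le hPd.le hg).trans (by omega))
    rw [jacobiInt_jacobi_mul_of_natDegree_lt ha hb (by omega)] at hquad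
    have hs : ∀ x, (P * (h - C c * P)).eval x = (P * h).eval x - c * (P.eval x * P.eval x) := by
      intro x
      simp only [eval_mul, eval_sub, eval_C]
      ring
    simp only [hs] at hquad
    simp only [mul_sub, mul_left_comm _ c] at hquad
    rw [Finset.sum_sub_distrib, ← Finset.mul_sum, sum_jglWeight_mul_jglLagrange ha hb hj,
      sum_jglWeight_mul_jacobi_sq ha hb] at hquad
    have hpos : jacobiGammaTilde a b (M + 1) (M + 1) ≠ 0 := by
      rw [jacobiGammaTilde, if_pos rfl]
      refine mul_ne_zero ?_ (jacobiGamma_pos ha hb _).ne'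
      have hM : (0 : ℝ) ≤ M := M.cast_nonneg
      push_cast
      have hM1 : (0 : ℝ) < M + 1 := by positivity
      rw [← mul_div_cancel_right₀ (2 : ℝ) hM1.ne', ← add_div]
      exact (div_pos (by linarith) hM1).ne'
    rw [tCoeff]
    field_simp
    linarith
  rw [hN]
  congr 1
  refine Finset.sum_congr rfl fun n hn => ?_
  have hn' := Finset.mem_range.1 hn
  congr 2
  -- For `n ≤ M` the product has degree at most `2M+1`, so its integral is the quadrature sum, which
  -- collapses to the node `x_j`.
  rw [jacobiInt_eq_sum_jglWeight ha hb M, sum_jglWeight_mul_jglLagrange ha hb hj, tCoeff,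
    jacobiGammaTilde, if_neg (by omega)]
  · ring
  · refine (natDegree_mul_le_of_le (jacobi_natDegree (by linarith) _).le hd.le).trans (by omega)

end

/-! ### The modified Riemann–Liouville derivative on polynomials -/

section

variable {μ : ℝ}

theorem integral_one_add_pow_mul_rpow (hμ1 : μ < 1) (k : ℕ) {x : ℝ} (hx : -1 < x) :
    ∫ y in (-1 : ℝ)..x, (1 + y) ^ k * (x - y) ^ (-μ) =
      (1 + x) ^ ((k : ℝ) + 1 - μ) *
        (k.factorial * Real.Gamma (1 - μ) / Real.Gamma ((k : ℝ) + 2 - μ)) := by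
  have hk : (-1 : ℝ) < k := by linarith [k.cast_nonneg (α := ℝ)]
  have h := intervalIntegral.integral_comp_add_left (a := -1) (b := x)
    (fun z : ℝ => z ^ (k : ℝ) * (1 + x - z) ^ (-μ)) 1
  rw [add_neg_cancel, integral_rpow_mul_sub_rpow hk (by linarith) (by linarith),
    Real.Gamma_nat_eq_factorial] at h
  rw [show (k : ℝ) + 1 - μ = k + -μ + 1 by ring, show 1 - μ = -μ + 1 by ring,
    show (k : ℝ) + 2 - μ = k + -μ + 2 by ring, ← h]
  congr 1
  ext y
  rw [Real.rpow_natCast]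
  congr 2
  ring

theorem intervalIntegrable_one_add_pow_mul_rpow (hμ1 : μ < 1) (k : ℕ) (x : ℝ) :
    IntervalIntegrable (fun y => (1 + y) ^ k * (x - y) ^ (-μ)) MeasureTheory.volume (-1) x := by
  have h := (intervalIntegral.intervalIntegrable_rpow' (a := x + 1) (b := 0) (r := -μ)
    (by linarith)).comp_sub_left x
  rw [show x - (x + 1) = -1 by ring, sub_zero] at h
  exact h.continuousOn_mul (by fun_prop)

theorem fracInt_sum (hμ1 : μ < 1) (c : ℕ → ℝ) (n : ℕ) {x : ℝ} (hx : -1 < x) :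
    fracInt (1 - μ) (fun y => ∑ k ∈ Finset.range n, c k * (1 + y) ^ k) x =
      ∑ k ∈ Finset.range n, c k * (k.factorial / Real.Gamma ((k : ℝ) + 2 - μ)) *
        (1 + x) ^ ((k : ℝ) + 1 - μ) := by
  have hG : Real.Gamma (1 - μ) ≠ 0 := (Real.Gamma_pos_of_pos (by linarith)).ne'
  rw [fracInt, sub_sub_cancel]
  rw [intervalIntegral.integral_congr_Ioo_of_le (g := fun y => ∑ k ∈ Finset.range n,
    c k * ((1 + y) ^ k * (x - y) ^ (-μ))) hx.le]
  · rw [intervalIntegral.integral_finsetSum fun k _ =>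
      (intervalIntegrable_one_add_pow_mul_rpow hμ1 k x).const_mul _, Finset.mul_sum]
    refine Finset.sum_congr rfl fun k _ => ?_
    rw [intervalIntegral.integral_const_mul, integral_one_add_pow_mul_rpow hμ1 k hx]
    field_simp
  · intro y hy
    simp only
    rw [Real.rpow_neg (by linarith [hy.2]), Finset.sum_div]
    refine Finset.sum_congr rfl fun k _ => ?_
    rw [div_eq_mul_inv, mul_assoc]

/-- The modified Riemann-Liouville derivative multiplies `(1+x)^k` by `k! / Γ(k+1-μ)`. -/
theorem modRLDeriv_sum (hμ0 : 0 < μ) (hμ1 : μ < 1) (c : ℕ → ℝ) (n : ℕ) {x : ℝ} (hx : -1 < x) :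
    modRLDeriv μ (fun y => ∑ k ∈ Finset.range n, c k * (1 + y) ^ k) x =
      ∑ k ∈ Finset.range n, c k * (k.factorial / Real.Gamma ((k : ℝ) + 1 - μ)) * (1 + x) ^ k := by
  have hceil : ⌈μ⌉₊ = 1 := by
    rw [Nat.ceil_eq_iff one_ne_zero]
    simp [hμ0, hμ1.le]
  have hx' : 0 < 1 + x := by linarith
  rw [modRLDeriv, rlDeriv, hceil, iteratedDeriv_one, Nat.cast_one]
  have hev : fracInt (1 - μ) (fun y => ∑ k ∈ Finset.range n, c k * (1 + y) ^ k) =ᶠ[nhds x]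
      fun x => ∑ k ∈ Finset.range n, c k * (k.factorial / Real.Gamma ((k : ℝ) + 2 - μ)) *
        (1 + x) ^ ((k : ℝ) + 1 - μ) := by
    filter_upwards [lt_mem_nhds hx] with z hz
    exact fracInt_sum hμ1 c n hz
  have hd : HasDerivAt (fun x => ∑ k ∈ Finset.range n,
      c k * (k.factorial / Real.Gamma ((k : ℝ) + 2 - μ)) * (1 + x) ^ ((k : ℝ) + 1 - μ))
      (∑ k ∈ Finset.range n, c k * (k.factorial / Real.Gamma ((k : ℝ) + 2 - μ)) *
        (1 * ((k : ℝ) + 1 - μ) * (1 + x) ^ ((k : ℝ) + 1 - μ - 1))) x :=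
    HasDerivAt.fun_sum fun k _ =>
      (((hasDerivAt_id x).const_add 1).rpow_const (Or.inl hx'.ne')).const_mul _
  rw [hev.deriv_eq, hd.deriv, Finset.mul_sum]
  refine Finset.sum_congr rfl fun k _ => ?_
  have hk : (0 : ℝ) < k + 1 - μ := by linarith [k.cast_nonneg (α := ℝ)]
  have hG : Real.Gamma ((k : ℝ) + 1 - μ) ≠ 0 := (Real.Gamma_pos_of_pos hk).ne'
  -- The prefactor `(1+x)^μ` exactly undoes the loss of exponent, which is why polynomials go to
  -- polynomials.
  have hpow : (1 + x) ^ μ * (1 + x) ^ ((k : ℝ) + 1 - μ - 1) = (1 + x) ^ k := by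
    rw [← Real.rpow_add hx', ← Real.rpow_natCast]
    congr 1
    ring
  rw [show (k : ℝ) + 2 - μ = k + 1 - μ + 1 by ring, Real.Gamma_add_one hk.ne', ← hpow]
  have := hk.ne'
  field_simp

/-- The modified Riemann-Liouville derivative as a linear operator on polynomials, which
multiplies `(1+X)^k` by `k! / Γ(k+1-μ)`. -/
noncomputable def modRLOp (μ : ℝ) : ℝ[X] →ₗ[ℝ] ℝ[X] :=
  taylor 1 ∘ₗ
    lsum (fun k => ((k.factorial : ℝ) / Real.Gamma ((k : ℝ) + 1 - μ)) • monomial k) ∘ₗ taylor (-1)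

theorem modRLOp_C_mul_pow (c : ℝ) (k : ℕ) :
    modRLOp μ (C c * (X + 1) ^ k) =
      C (c * (k.factorial / Real.Gamma ((k : ℝ) + 1 - μ))) * (X + 1) ^ k := by
  have h : taylor (-1) (C c * (X + 1) ^ k) = monomial k c := by
    rw [taylor_mul, taylor_pow, map_add, taylor_C, taylor_X, taylor_one, C_neg, C_1,
      neg_add_cancel_right, C_mul_X_pow_eq_monomial]
  rw [modRLOp, LinearMap.comp_apply, LinearMap.comp_apply, h, lsum_apply,
    sum_monomial_index _ _ (by simp), LinearMap.smul_apply, smul_monomial, taylor_monomial,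
    smul_eq_mul, mul_comm c, C_1]

theorem eq_sum_taylor_neg_one (Q : ℝ[X]) {n : ℕ} (hn : Q.natDegree < n) :
    Q = ∑ k ∈ Finset.range n, C ((taylor (-1) Q).coeff k) * (X + 1) ^ k := by
  conv_lhs => rw [← sum_taylor_eq Q (-1)]
  rw [sum_over_range' _ (by simp) n (by rwa [natDegree_taylor])]
  simp

theorem modRLOp_eq_sum (Q : ℝ[X]) {n : ℕ} (hn : Q.natDegree < n) :
    modRLOp μ Q = ∑ k ∈ Finset.range n,
      C ((taylor (-1) Q).coeff k * (k.factorial / Real.Gamma ((k : ℝ) + 1 - μ))) *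
        (X + 1) ^ k := by
  conv_lhs => rw [eq_sum_taylor_neg_one Q hn, map_sum]
  exact Finset.sum_congr rfl fun k _ => modRLOp_C_mul_pow _ _

theorem modRLDeriv_eval (hμ0 : 0 < μ) (hμ1 : μ < 1) (Q : ℝ[X]) {x : ℝ} (hx : -1 < x) :
    modRLDeriv μ (fun y => Q.eval y) x = (modRLOp μ Q).eval x := by
  have h : (fun y => Q.eval y) = fun y => ∑ k ∈ Finset.range (Q.natDegree + 1),
      (taylor (-1) Q).coeff k * (1 + y) ^ k := by
    ext y
    conv_lhs => rw [eq_sum_taylor_neg_one Q Q.natDegree.lt_succ_self]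
    simp [eval_finsetSum, add_comm]
  rw [h, modRLDeriv_sum hμ0 hμ1 _ _ hx, modRLOp_eq_sum Q Q.natDegree.lt_succ_self]
  simp [eval_finsetSum, add_comm]

/-- Only the `k = 0` term survives. At `-1` the operator replaces the analytic derivative, whose
prefactor `(1+x)^μ` vanishes there. -/
theorem modRLOp_eval_neg_one (Q : ℝ[X]) :
    (modRLOp μ Q).eval (-1) = Q.eval (-1) / Real.Gamma (1 - μ) := by
  rw [modRLOp_eq_sum Q Q.natDegree.lt_succ_self, Finset.sum_range_succ']
  simp [eval_finsetSum, taylor_coeff_zero, div_eq_mul_inv]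

theorem taylor_modRLOp_coeff (Q : ℝ[X]) (k : ℕ) :
    (taylor (-1) (modRLOp μ Q)).coeff k =
      (taylor (-1) Q).coeff k * (k.factorial / Real.Gamma ((k : ℝ) + 1 - μ)) := by
  have h : taylor (-1) (X + 1 : ℝ[X]) = X := by
    rw [map_add, taylor_X, taylor_one, C_neg, C_1, neg_add_cancel_right]
  rw [modRLOp_eq_sum Q (n := Q.natDegree + 1 + k) (by omega), map_sum, finsetSum_coeff,
    Finset.sum_eq_single k]
  · rw [taylor_mul, taylor_pow, h, taylor_C, coeff_C_mul_X_pow, if_pos rfl]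
  · intro m _ hm
    rw [taylor_mul, taylor_pow, h, taylor_C, coeff_C_mul_X_pow, if_neg hm.symm]
  · intro hk
    exact absurd (Finset.mem_range.2 (by omega)) hk

theorem modRLOp_natDegree_le {Q : ℝ[X]} {n : ℕ} (h : Q.natDegree ≤ n) :
    (modRLOp μ Q).natDegree ≤ n := by
  rw [← natDegree_taylor _ (-1), natDegree_le_iff_coeff_eq_zero]
  intro k hk
  rw [taylor_modRLOp_coeff, coeff_eq_zero_of_natDegree_lt (by rw [natDegree_taylor]; omega),
    zero_mul]

theorem modRLOp_injective (hμ1 : μ < 1) : Function.Injective (modRLOp μ) := by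
  rw [injective_iff_map_eq_zero]
  intro Q hQ
  rw [← taylor_eq_zero (-1)]
  ext k
  have h := taylor_modRLOp_coeff (μ := μ) Q k
  rw [hQ, map_zero, coeff_zero] at h
  have hG : Real.Gamma ((k : ℝ) + 1 - μ) ≠ 0 :=
    (Real.Gamma_pos_of_pos (by linarith [k.cast_nonneg (α := ℝ)])).ne'
  have hf : (k.factorial : ℝ) ≠ 0 := by positivity
  rw [coeff_zero]
  exact (mul_eq_zero.1 h.symm).resolve_right (div_ne_zero hf hG)

theorem ascPochhammer_eval_mul_Gamma {z : ℝ} (hz : 0 < z) (m : ℕ) :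
    (ascPochhammer ℝ m).eval z * Real.Gamma z = Real.Gamma (z + m) := by
  induction m with
  | zero => simp
  | succ m ih =>
    have : z + m ≠ 0 := by positivity
    rw [ascPochhammer_succ_eval, mul_right_comm, ih, Nat.cast_succ, ← add_assoc,
      Real.Gamma_add_one this, mul_comm]

/-- Reflection moves the expansion point from `1` to `-1`, where `modRLOp` is diagonal, at the cost
of swapping the parameters. -/
theorem jacobi_eq_sum_X_add_one {a b : ℝ} (hab : -2 < a + b) (n : ℕ) :
    jacobi a b n = ∑ k ∈ Finset.range (n + 1),
      C ((-1) ^ n * (jacobiCoeff b a n k * (-1 / 2) ^ k)) * (X + 1) ^ k := by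
  have h := jacobi_comp_neg_X (a := b) (b := a) (by linarith) n
  have h' : jacobi a b n = C ((-1) ^ n) * (jacobi b a n).comp (-X) := by
    rw [h, ← mul_assoc, ← C_mul, ← mul_pow]
    simp
  have e : (C (1 / 2 : ℝ) * (-X - 1) : ℝ[X]) = C (-1 / 2) * (X + 1) := by
    rw [neg_div, C_neg]; ring
  rw [h', jacobi_eq_comp, jacobiAux, Polynomial.sum_comp, Polynomial.sum_comp, Finset.mul_sum]
  refine Finset.sum_congr rfl fun k _ => ?_
  simp only [mul_comp, C_comp, pow_comp, sub_comp, X_comp, one_comp]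
  rw [e, mul_pow, ← C_pow]
  simp only [C_mul]
  ring

/-- The parameter sum is `0` on both sides, so the factors `(n+1)_k` agree; the rest is `(k+1)_{n-k}
= n!/k!` against `(k+1-μ)_{n-k} = Γ(n+1-μ)/Γ(k+1-μ)`. -/
theorem jacobiCoeff_zero_mul (hμ1 : μ < 1) {n k : ℕ} (hk : k ≤ n) :
    jacobiCoeff 0 0 n k * (k.factorial / Real.Gamma ((k : ℝ) + 1 - μ)) =
      n.factorial / Real.Gamma ((n : ℝ) + 1 - μ) * jacobiCoeff (-μ) μ n k := by
  have hk0 : (0 : ℝ) ≤ k := k.cast_nonneg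
  have hn0 : (0 : ℝ) ≤ n := n.cast_nonneg
  have h1 := ascPochhammer_eval_mul_Gamma (z := (k : ℝ) + 1) (by linarith) (n - k)
  have h2 := ascPochhammer_eval_mul_Gamma (z := (k : ℝ) + 1 - μ) (by linarith) (n - k)
  rw [Nat.cast_sub hk, show (k : ℝ) + 1 + (n - k) = n + 1 by ring, Real.Gamma_nat_eq_factorial,
    Real.Gamma_nat_eq_factorial] at h1
  rw [Nat.cast_sub hk, show (k : ℝ) + 1 - μ + (n - k) = n + 1 - μ by ring] at h2
  have g1 : Real.Gamma ((k : ℝ) + 1 - μ) ≠ 0 := (Real.Gamma_pos_of_pos (by linarith)).ne'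
  have g2 : Real.Gamma ((n : ℝ) + 1 - μ) ≠ 0 := (Real.Gamma_pos_of_pos (by linarith)).ne'
  simp only [jacobiCoeff]
  rw [show (n : ℝ) + 0 + 0 + 1 = n + 1 by ring, show (n : ℝ) + -μ + μ + 1 = n + 1 by ring,
    show (0 : ℝ) + k + 1 = k + 1 by ring, show -μ + (k : ℝ) + 1 = k + 1 - μ by ring,
    mul_div_assoc', div_mul_eq_mul_div, div_mul_eq_mul_div, mul_assoc _ _ (k.factorial : ℝ), h1]
  rw [← h2]
  rw [← h2] at g2
  have := (mul_ne_zero_iff.1 g2).1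
  field_simp

/-- The modified Riemann-Liouville derivative maps Legendre polynomials to multiples of the
Jacobi polynomials `P_n^{(μ,-μ)}`. -/
theorem modRLOp_legendre (hμ1 : μ < 1) (n : ℕ) :
    modRLOp μ (legendre n) =
      C (n.factorial / Real.Gamma ((n : ℝ) + 1 - μ)) * jacobi μ (-μ) n := by
  rw [legendre, jacobi_eq_sum_X_add_one (by norm_num), jacobi_eq_sum_X_add_one (by simp),
    map_sum, Finset.mul_sum]
  refine Finset.sum_congr rfl fun k hk => ?_
  rw [modRLOp_C_mul_pow, ← mul_assoc (C _), ← C_mul]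
  congr 2
  have := jacobiCoeff_zero_mul hμ1 (Nat.lt_succ_iff.1 (Finset.mem_range.1 hk))
  linear_combination (-1) ^ n * (-1 / 2) ^ k * this

end

/-! ### Connection coefficients and the Birkhoff conditions -/

/-- The connection between two families of Jacobi polynomials. -/
theorem jacobi_eq_sum_connCoeff (α β : ℝ) {a b : ℝ} (ha : -1 < a) (hb : -1 < b)
    (hαβ : -2 < α + β) (n : ℕ) :
    jacobi α β n = ∑ l ∈ Finset.range (n + 1), C (connCoeff α β a b l n) * jacobi a b l := by
  conv_lhs => rw [eq_sum_jacobi ha hb (jacobi_natDegree hαβ n).le]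
  refine Finset.sum_congr rfl fun l _ => ?_
  simp only [connCoeff, jacobiInt_apply, eval_mul]

theorem sum_tHat_mul_jacobi {α β μ : ℝ} (hα : -1 < α) (hβ : -1 < β) (hμ0 : 0 < μ) (hμ1 : μ < 1)
    {M j : ℕ} (hj : j < M + 2) :
    ∑ l ∈ Finset.range (M + 1 + 1), C (tHat α β μ (M + 1) l j) * jacobi μ (-μ) l =
      jglLagrange α β (M + 1) j := by
  rw [jglLagrange_eq_sum hα hβ hj]
  have h : ∀ n, C (tCoeff α β (M + 1) n j) * jacobi α β n = ∑ l ∈ Finset.range (n + 1),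
      C (connCoeff α β μ (-μ) l n * tCoeff α β (M + 1) n j) * jacobi μ (-μ) l := by
    intro n
    conv_lhs => rw [jacobi_eq_sum_connCoeff α β (a := μ) (b := -μ) (by linarith) (by linarith)
      (by linarith), Finset.mul_sum]
    refine Finset.sum_congr rfl fun l _ => ?_
    rw [C_mul]
    ring
  simp only [h, tHat, map_sum, Finset.sum_mul]
  -- Both orders of summation run over the triangle `0 ≤ l ≤ n ≤ N`.
  refine Finset.sum_comm' fun l n => ?_
  simp only [Finset.mem_range, Finset.mem_Icc]
  omega

theorem modRLOp_sum_legendre {α β μ : ℝ} (hα : -1 < α) (hβ : -1 < β) (hμ0 : 0 < μ)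
    (hμ1 : μ < 1) {M j : ℕ} (hj : j < M + 2) (z : ℝ) :
    modRLOp μ (C z * ∑ l ∈ Finset.range (M + 1 + 1),
      C (Real.Gamma ((l : ℝ) - μ + 1) / (l.factorial : ℝ) * tHat α β μ (M + 1) l j) *
        legendre l) = C z * jglLagrange α β (M + 1) j := by
  rw [← smul_eq_C_mul, map_smul, smul_eq_C_mul, map_sum, ← sum_tHat_mul_jacobi hα hβ hμ0 hμ1 hj]
  congr 1
  refine Finset.sum_congr rfl fun l _ => ?_
  rw [← smul_eq_C_mul, map_smul, smul_eq_C_mul, modRLOp_legendre hμ1, ← mul_assoc, ← C_mul]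
  congr 2
  have hG : Real.Gamma ((l : ℝ) + 1 - μ) ≠ 0 :=
    (Real.Gamma_pos_of_pos (by linarith [l.cast_nonneg (α := ℝ)])).ne'
  have hf : (l.factorial : ℝ) ≠ 0 := by positivity
  rw [show (l : ℝ) - μ + 1 = l + 1 - μ by ring]
  field_simp

/-- The Birkhoff conditions say that the modified Riemann-Liouville derivative is a multiple of a
Lagrange basis polynomial. -/
theorem isBirkhoffBasisPoly_iff {α β μ : ℝ} (hα : -1 < α) (hβ : -1 < β) (hμ0 : 0 < μ)
    (hμ1 : μ < 1) {M j : ℕ} (hj : j < M + 2) {Q : ℝ[X]} :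
    IsBirkhoffBasisPoly α β μ (M + 1) j Q ↔
      Q.natDegree ≤ M + 1 ∧
        modRLOp μ Q = C (zetaConst μ j) * jglLagrange α β (M + 1) j := by
  have hG : Real.Gamma (1 - μ) ≠ 0 := (Real.Gamma_pos_of_pos (by linarith)).ne'
  have hval : ∀ i < M + 2, (C (zetaConst μ j) * jglLagrange α β (M + 1) j).eval
      (jglNode α β (M + 1) i) = zetaConst μ j * if i = j then 1 else 0 := fun i hi => by
    rw [eval_mul, eval_C, jglLagrange_eval_jglNode hα hβ hi hj]
  have hzeta : ∀ i, 0 < i → zetaConst μ j * (if i = j then 1 else 0) = if i = j then 1 else 0 := by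
    intro i hi
    split_ifs with h
    · rw [zetaConst, if_neg (by omega), mul_one]
    · rw [mul_zero]
  have hzeta0 : zetaConst μ j * (if 0 = j then 1 else 0) =
      (if j = 0 then 1 else 0) / Real.Gamma (1 - μ) := by
    rcases Nat.eq_zero_or_pos j with rfl | h
    · simp [zetaConst]
    · simp [h.ne, h.ne']
  have hnode : ∀ i, 0 < i → i < M + 2 → modRLDeriv μ (fun x => Q.eval x) (jglNode α β (M + 1) i) =
      (modRLOp μ Q).eval (jglNode α β (M + 1) i) := fun i h0 h1 =>
    modRLDeriv_eval hμ0 hμ1 Q (neg_one_lt_jglNode hα hβ h0 h1)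
  constructor
  · rintro ⟨hdeg, hder, hleft⟩
    have hdeg' : Q.natDegree ≤ M + 1 := natDegree_le_iff_degree_le.2 hdeg
    -- Both polynomials have degree below the number `M+2` of nodes; the value at `x_0 = -1` comes
    -- from the condition on `Q(-1)`, the others from the derivative conditions.
    refine ⟨hdeg', Polynomial.eq_of_degrees_lt_of_eval_index_eq _ (jglNode_injOn hα hβ M) ?_ ?_ ?_⟩
    · rw [Finset.card_range]
      refine (degree_le_of_natDegree_le (modRLOp_natDegree_le hdeg')).trans_lt ?_
      exact_mod_cast (M + 1).lt_succ_self
    · rw [Finset.card_range]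
      refine (degree_le_of_natDegree_le ((natDegree_C_mul_le _ _).trans
        (jglLagrange_natDegree hα hβ hj).le)).trans_lt ?_
      exact_mod_cast (M + 1).lt_succ_self
    · intro i hi
      have hi' := Finset.mem_range.1 hi
      rw [hval i hi']
      rcases i.eq_zero_or_pos with rfl | h0
      · rw [jglNode_zero hα hβ, modRLOp_eval_neg_one, hleft, hzeta0]
      · rw [← hnode i h0 hi', hder i h0 (Nat.lt_succ_iff.1 hi'), hzeta i h0]
  · rintro ⟨hdeg, hQ⟩
    refine ⟨degree_le_of_natDegree_le hdeg, fun i h0 h1 => ?_, ?_⟩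
    · rw [hnode i h0 (Nat.lt_succ_iff.2 h1), hQ, hval i (Nat.lt_succ_iff.2 h1), hzeta i h0]
    · have h := hval 0 (by omega)
      rw [jglNode_zero hα hβ, ← hQ, modRLOp_eval_neg_one, hzeta0] at h
      exact (div_left_inj' hG).1 h

end RLBirkhoff

theorem theorem5p2 (α β μ : ℝ) (hα : -1 < α) (hβ : -1 < β) (hμ0 : 0 < μ) (hμ1 : μ < 1)
    (N : ℕ) (hN : 1 ≤ N) (j : ℕ) (hj : j ≤ N) (Q : Polynomial ℝ) :
    RLBirkhoff.IsBirkhoffBasisPoly α β μ N j Q ↔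
      Q = Polynomial.C (RLBirkhoff.zetaConst μ j) *
        ∑ l ∈ Finset.range (N + 1),
          Polynomial.C (Real.Gamma ((l : ℝ) - μ + 1) / (l.factorial : ℝ)
            * RLBirkhoff.tHat α β μ N l j) * RLBirkhoff.legendre l := by
  obtain ⟨M, rfl⟩ := Nat.exists_eq_add_of_le' hN
  have hj' : j < M + 2 := Nat.lt_succ_iff.2 hj
  rw [RLBirkhoff.isBirkhoffBasisPoly_iff hα hβ hμ0 hμ1 hj',
    ← RLBirkhoff.modRLOp_sum_legendre hα hβ hμ0 hμ1 hj', (RLBirkhoff.modRLOp_injective hμ1).eq_iff]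
  -- Injectivity has already settled the equation; only the degree bound for the explicit polynomial
  -- is left.
  refine and_iff_right_of_imp fun h => ?_
  rw [h]
  refine (natDegree_C_mul_le _ _).trans (natDegree_sum_le_of_forall_le _ _ fun l hl => ?_)
  refine (natDegree_C_mul_le _ _).trans ?_
  rw [RLBirkhoff.legendre, RLBirkhoff.jacobi_natDegree (by norm_num)]
  exact Nat.lt_succ_iff.1 (Finset.mem_range.1 hl)
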